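/- **Setting.** For powers of two $b,c$ and $a\ge 1$, consider the Boolean variables consisting of the bits $(f_i(x))_j$ of $f_i(x)\in[0,b)$ for $i<a-1$, $x<b$; the values $G_i(x,y)$ for $i<a$, $x<b$, $y<c$; and the bits of $u(x)\in[0,c)$ for $x<b$. They are stored at distinct positions of an oracle $\alpha$; all other positions of $\alpha$ are fixed (or left undefined) arbitrarily. A *restriction* is a partial assignment to the variables. In a restriction in which each $f_i(x)$ is completely defined or completely undefined, a *path* is a maximal sequence of nodes $(i,x_0),(i+1,x_1),\dots$ with $f_{i+j}(x_j)=x_{j+1}$. A restriction is *legal* if each $f_i(x)$ is completely defined or completely undefined, all $f_i$ are partial injections, and every path is of one of these kinds: no variable $G_i(x,y)$ of a node $(i,x)$ on it is set; or it begins at $(0,0)$ and $G_i(x,y)=0$ for all its nodes $(i,x)$ and all $y$; or it does not begin at $(0,0)$ and there is a colour $z$ such that for all its nodes $G_i(x,z)=1$ and $G_i(x,y)=0$ for $y\ne z$. Moreover $u(x)=z$ if $(a-1,x)$ is on a path of the third kind with colour $z$, and $u(x)$ is completely undefined for all other $x$. The *random restriction* $\rho\sim\mathcal R_{p,q}$ is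 chosen as follows. Each $(i,x)$ with $i<a-1$, $x<b$ is put into a set $Z$ independently with probability $1-p$; each $f_i$ is chosen independently and uniformly among the injections from $\{x<b:(i,x)\in Z\}$ into $[0,b)$. On the path beginning at $(0,0)$ all $G_i(x,y)$ are set to $0$. Independently, every other path is left uncoloured with probability $q$, and otherwise gets a uniformly random colour $z<c$: all its nodes get $G_i(x,z)=1$ and $G_i(x,y)=0$ for $y\neq z$, and $u(x)=z$ if it contains $(a-1,x)$. Nothing else is set. A $\mathrm P^{\mathrm{NP}}$ machine is a deterministic polynomial-time machine asking queries to an $\mathrm{NP}^\alpha$ set, and accessing $\alpha$ only through these queries; its running time is polynomially bounded whatever replies it gets. A *precomputation* of it on a given input, in a partial oracle, is a sequence of queries, YES/NO replies, and witnesses for the YES replies, such that the queries are those that the machine asks until it halts if it gets these replies, and the witnesses are correct (their verification asks only for defined bits of the oracle and accepts); the NO replies may be wrong. A restriction $\rho$ *fixes* a precomputation if its witnesses are correct in $\rho$ and no query with reply NO has a correct witness in any legal $\sigma\supseteq\rho$. For $\mathrm P^{\mathrm{NP}}$ functions $f_x(u)$, $g_x(v)$ we write $\rho\Vdash f_x(g_x(v))=v'$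 if $\rho$ fixes a precomputation with output $v'$ of the machine that first computes $u=g_x(v)$ and then $f_x(u)$. An $\mathrm{rWPHP}_2$ problem is given by $\mathrm P^{\mathrm{NP}}$ machines for functions $f_x(u)$ and $g_x(v)$ such that in all precomputations the output of $f_x(u)$ is less than $2x$ if $u<x$, and the output of $g_x(v)$ is less than $x$ if $v<2x$. **Lemma.** Let an $\mathrm{rWPHP}_2$ problem be given by $f,g$. Let $s=s(n)\ge 1$ be quasipolynomially bounded in $n$, that is, $s(n)\le 2^{(\log n)^{k}}$ for some constant $k$ and all large $n$, and let $\delta<1/7$. Then for all sufficiently large $n$ such that $n^{1/7}$ is a power of two, with $a=b=n$, $c=n^{1/7}$, $p=n^{-4/7}$, $q=n^{-2/7}$, $$\Pr_{\rho\sim\mathcal R_{p,q}}\bigl[\text{there are } v<2s \text{ and } v'\neq v \text{ such that } \rho\Vdash f_s(g_s(v))=v'\bigr]\ \ge\ 1-3n^{-\delta}.$$ -/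

import Mathlib

open Filter Topology

/-! ### Oracle machines with a step count

A machine has finitely many states and finitely many stacks of bits: two input stacks, a query
stack, an output stack and any number of work stacks (two stacks make up one tape). The content of
the query stack is the string that is asked when the machine enters a querying state. -/

/-- The names of the stacks of a machine with `k` work stacks. -/
inductive StackName (k : ℕ) : Type
  | inputA : StackName k
  | inputB : StackName k
  | query : StackName k
  | output : StackName k
  | work : Fin k → StackName k

/-- What can be done to one stack in one step. -/
inductive StackOp : Type
  | keep : StackOp
  | pop : StackOp
  | push : Bool → StackOp

/-- The effect of an operation on the content of a stack (the head of the list is the top). -/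
def StackOp.apply : StackOp → List Bool → List Bool
  | .keep, l => l
  | .pop, l => l.tail
  | .push b, l => b :: l

/-- The instructions of a machine with state set `S` and `k` work stacks. -/
inductive Instr (S : Type) (k : ℕ) : Type
  | halt : Instr S k
  | move : S → (StackName k → StackOp) → Instr S k
  /-- ask the oracle about the content of the query stack and go to a state given by the reply -/
  | ask : (Bool → S) → Instr S k

/-- A deterministic oracle machine. The instruction to be executed depends on the state and on the
top symbols of the stacks (`none` for an empty stack). -/
structure OracleMachine where
  State : Type
  finite_state : Finite State
  work : ℕ
  start : State
  instr : State → (StackName work → Option Bool) → Instr State work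

namespace OracleMachine

/-- A configuration: a state and the contents of all stacks. -/
structure Config (M : OracleMachine) where
  state : M.State
  stack : StackName M.work → List Bool

/-- The start configuration on the pair of inputs `(a, b)`. -/
def init (M : OracleMachine) (a b : List Bool) : M.Config where
  state := M.start
  stack := fun
    | .inputA => a
    | .inputB => b
    | _ => []

/-- The possible results of one step: the machine has halted, it moves to a configuration, or it
asks a query and continues in a configuration that depends on the reply. -/
inductive StepResult (C : Type) : Type
  | halted : StepResult C
  | next : C → StepResult C
  | asks : List Bool → (Bool → C) → StepResult C

/-- One step of the machine. -/
def step (M : OracleMachine) (c : M.Config) : StepResult M.Config :=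
  match M.instr c.state (fun i => (c.stack i).head?) with
  | .halt => .halted
  | .move s ops => .next ⟨s, fun i => (ops i).apply (c.stack i)⟩
  | .ask s => .asks (c.stack .query) (fun r => ⟨s r, c.stack⟩)

/-- `M.Run c l d`: started in `c`, the machine halts in the configuration `d`, and `l` is the
list of the queries that it asks on the way, in order, with the replies that it gets. -/
inductive Run (M : OracleMachine) : M.Config → List (List Bool × Bool) → M.Config → Prop
  | halted {c : M.Config} : M.step c = .halted → Run M c [] c
  | next {c c' d : M.Config} {l : List (List Bool × Bool)} :
      M.step c = .next c' → Run M c' l d → Run M c l d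
  | asks {c d : M.Config} {q : List Bool} {k : Bool → M.Config} {r : Bool}
      {l : List (List Bool × Bool)} :
      M.step c = .asks q k → Run M (k r) l d → Run M c ((q, r) :: l) d

/-- Started in `c`, the machine halts within `t` steps, whatever replies it gets. -/
def HaltsWithin (M : OracleMachine) : ℕ → M.Config → Prop
  | 0, c => M.step c = .halted
  | t + 1, c =>
    match M.step c with
    | .halted => True
    | .next c' => M.HaltsWithin t c'
    | .asks _ k => ∀ r : Bool, M.HaltsWithin t (k r)

/-- The machine runs in polynomial time (in the total length of its two inputs). -/
def PolyTime (M : OracleMachine) : Prop :=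
  ∃ p : Polynomial ℕ, ∀ a b : List Bool,
    M.HaltsWithin (p.eval (a.length + b.length)) (M.init a b)

end OracleMachine

/-- A partial oracle: some bits may be undefined. -/
abbrev PartialOracle : Type := List Bool → Option Bool

/-- The run of `M` on `(a, b)` with oracle `A` only asks for defined bits of `A`, and it ends with
`1` on top of the output stack. -/
def OracleMachine.Accepts (M : OracleMachine) (A : PartialOracle) (a b : List Bool) : Prop :=
  ∃ (l : List (List Bool × Bool)) (d : M.Config), M.Run (M.init a b) l d ∧
    (∀ e ∈ l, A e.1 = some e.2) ∧ (d.stack .output).head? = some true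

/-- The number with the given binary digits, least significant digit first. -/
def natOfBits (l : List Bool) : ℕ := Nat.ofDigits 2 (l.map Bool.toNat)

/-! ### P^NP machines and their precomputations -/

/-- A `P^NP` machine, relative to an oracle for bits: a polynomial-time machine `base` asking
queries to the `NP` set of all strings `q` for which there is a string `y` of length at most
`witnessBound |q|` such that the polynomial-time machine `verifier` accepts `(q, y)`. Only the
verifier has access to the bits of the oracle. -/
structure PNPMachine where
  base : OracleMachine
  base_polyTime : base.PolyTime
  verifier : OracleMachine
  verifier_polyTime : verifier.PolyTime
  witnessBound : Polynomial ℕ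

namespace PNPMachine

/-- In the partial oracle `A`, the string `y` witnesses that the reply to the query `q` is YES. -/
def IsWitness (M : PNPMachine) (A : PartialOracle) (q y : List Bool) : Prop :=
  y.length ≤ M.witnessBound.eval q.length ∧ M.verifier.Accepts A q y

/-- A precomputation is a sequence of queries with replies: `(q, none)` is a query `q` with reply
NO, and `(q, some y)` is a query `q` with reply YES and the alleged witness `y` for it.

`M.IsPrecomputation A w x v z`: in the partial oracle `A`, the sequence `w` is a precomputation
of `M` on the inputs `x` (the parameter) and `v`, with output `z`. The queries are those which `M`
asks if it gets the replies in `w`, and the witnesses in `w` are correct in `A`; the replies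
NO may be wrong. -/
def IsPrecomputation (M : PNPMachine) (A : PartialOracle)
    (w : List (List Bool × Option (List Bool))) (x v z : ℕ) : Prop :=
  (∃ d : M.base.Config,
    M.base.Run (M.base.init (Nat.bits x) (Nat.bits v)) (w.map fun e => (e.1, e.2.isSome)) d ∧
      natOfBits (d.stack .output) = z) ∧
  ∀ q y, (q, some y) ∈ w → M.IsWitness A q y

end PNPMachine

/-- The data of a problem in the class `rWPHP₂`: two `P^NP` machines for functions `f_x(u)` and
`g_x(v)`, constrained to take values less than `2x` on arguments `u < x`, and values less than `x`
on arguments `v < 2x`. The constraint applies to all precomputations. -/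
structure RetractionWPHP where
  f : PNPMachine
  g : PNPMachine
  f_lt : ∀ (A : PartialOracle) (w : List (List Bool × Option (List Bool))) (x u z : ℕ),
    u < x → f.IsPrecomputation A w x u z → z < 2 * x
  g_lt : ∀ (A : PartialOracle) (w : List (List Bool × Option (List Bool))) (x v z : ℕ),
    v < 2 * x → g.IsPrecomputation A w x v z → z < x

/-! ### Coloured polynomial local search: variables and restrictions -/

/-- The propositional variables of CPLS with parameters `a`, `b`, `c` (where `b` and `c` are powers
of two): the bits of `f_i(x)` for `i < a - 1`, the truth values `G_i(x, y)`, and the bits of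
`u(x)`. -/
inductive CPLSVar (a b c : ℕ) : Type
  | f : Fin (a - 1) → Fin b → Fin (Nat.log 2 b) → CPLSVar a b c
  | G : Fin a → Fin b → Fin c → CPLSVar a b c
  | u : Fin b → Fin (Nat.log 2 c) → CPLSVar a b c

/-- Partial assignments to the variables. -/
abbrev Restriction (a b c : ℕ) : Type := CPLSVar a b c → Option Bool

/-- `σ` extends `ρ`. -/
def Restriction.Extends {a b c : ℕ} (σ ρ : Restriction a b c) : Prop :=
  ∀ (v : CPLSVar a b c) (e : Bool), ρ v = some e → σ v = some e

open Classical in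
/-- The partial oracle given by a restriction `ρ`, where `code` tells at which position of the
oracle a variable is stored, and `rest` is the content of all the positions at which no variable
is stored. -/
noncomputable def Restriction.toOracle {a b c : ℕ} (code : CPLSVar a b c ↪ List Bool)
    (rest : PartialOracle) (ρ : Restriction a b c) : PartialOracle :=
  fun s => if h : ∃ v, code v = s then ρ h.choose else rest s

/-- Nodes `(i, x)` of the graph: node `x` on level `i`. -/
abbrev Node (a b : ℕ) : Type := Fin a × Fin b

/-- Families of partial functions `f_i`, for `i < a - 1`. -/
abbrev PartialMaps (a b : ℕ) : Type := Fin (a - 1) → Fin b → Option (Fin b)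

namespace PartialMaps

variable {a b : ℕ}

/-- All `f_i` are partial injections. -/
def Injective (F : PartialMaps a b) : Prop :=
  ∀ i x x' z, F i x = some z → F i x' = some z → x = x'

/-- The node `μ` is the neighbour of `ν`: `ν = (i, x)` and `μ = (i + 1, f_i(x))`. -/
def Edge (F : PartialMaps a b) (ν μ : Node a b) : Prop :=
  ∃ i : Fin (a - 1), ν.1.val = i.val ∧ μ.1.val = i.val + 1 ∧ F i ν.2 = some μ.2

/-- The node `h` is the first node of a path (a maximal sequence of nodes, each of which is
the neighbour of the one before it). -/
def IsHead (F : PartialMaps a b) (h : Node a b) : Prop := ∀ ν, ¬ F.Edge ν h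

/-- The first nodes of paths. A path is determined by its first node. -/
def Head (F : PartialMaps a b) : Type := {h : Node a b // F.IsHead h}

/-- The node `ν` is on the path with first node `h`. -/
def OnPath (F : PartialMaps a b) (h : F.Head) (ν : Node a b) : Prop :=
  Relation.ReflTransGen F.Edge h.1 ν

/-- The path begins at node `0` on level `0`. -/
def IsRoot (F : PartialMaps a b) (h : F.Head) : Prop := h.1.1.val = 0 ∧ h.1.2.val = 0

end PartialMaps

/-- The possible states of a path: not coloured, all colours absent, or exactly one colour `z`. -/
inductive PathState (c : ℕ) : Type
  | uncoloured : PathState c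
  | zero : PathState c
  | single : Fin c → PathState c

/-- The value of `G_i(x, y)` for a node `(i, x)` on a path in the given state. -/
def PathState.colourValue {c : ℕ} (t : PathState c) (y : Fin c) : Option Bool :=
  match t with
  | .uncoloured => none
  | .zero => some false
  | .single z => some (decide (y = z))

/-- The value of the `j`-th bit of `u(x)` for a node `x` of the bottom level on a path in the given
state. -/
def PathState.bitValue {c : ℕ} (t : PathState c) (j : Fin (Nat.log 2 c)) : Option Bool :=
  match t with
  | .uncoloured => none
  | .zero => none
  | .single z => some (z.val.testBit j.val)

/-- A restriction is legal if every `f_i(x)` is completely defined or completely undefined, the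
`f_i` are partial injections, and every path is uncoloured (no `G_i(x, y)` and no `u(x)` is set on
it), or it begins at node `0` of level `0` and all `G_i(x, y)` on it are set to `0` (and no `u(x)`
is set on it), or it does not begin there and it has exactly one colour `z`, the same at all its
nodes, and `u(x) = z` if it reaches the bottom level at `x`. -/
def Restriction.Legal {a b c : ℕ} (ρ : Restriction a b c) : Prop :=
  ∃ F : PartialMaps a b, F.Injective ∧
    (∀ i x j, ρ (.f i x j) = (F i x).map fun z => z.val.testBit j.val) ∧
    ∀ h : F.Head, ∃ t : PathState c,
      (t = .uncoloured ∨ (t = .zero ∧ F.IsRoot h) ∨ ((∃ z, t = .single z) ∧ ¬ F.IsRoot h)) ∧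
      ∀ ν : Node a b, F.OnPath h ν →
        (∀ y, ρ (.G ν.1 ν.2 y) = t.colourValue y) ∧
        (ν.1.val + 1 = a → ∀ j, ρ (.u ν.2 j) = t.bitValue j)

/-! ### Random restrictions -/

/-- The joint distribution of finitely many independent random variables. -/
noncomputable def PMF.independent {ι : Type} [Fintype ι] [DecidableEq ι] {α : ι → Type}
    [∀ i, Fintype (α i)] (μ : ∀ i, PMF (α i)) : PMF (∀ i, α i) :=
  PMF.ofFintype (fun g => ∏ i, μ i (g i)) (by
    have h := Finset.prod_univ_sum (fun i => (Finset.univ : Finset (α i))) (fun i e => μ i e)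
    rw [Fintype.piFinset_univ] at h
    rw [← h]
    refine Finset.prod_eq_one fun i _ => ?_
    rw [← tsum_fintype (L := .unconditional _)]
    exact (μ i).tsum_coe)

/-- A coin which shows `true` with probability `p`. -/
noncomputable def PMF.coin (p : unitInterval) : PMF Bool :=
  PMF.ofFintype (fun e => ENNReal.ofReal (if e then (p : ℝ) else 1 - p)) (by
    have h0 : (0 : ℝ) ≤ p := p.2.1
    have h1 : (0 : ℝ) ≤ 1 - p := sub_nonneg.2 p.2.2
    simp [← ENNReal.ofReal_add h0 h1])

namespace RandomRestriction

variable {a b : ℕ}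

/-- The domain `{x : (i, x) ∈ Z}` of `f_i`, where the set `Z` of nodes is given by `Z ν = true` for
the nodes `ν` that are *not* in it. -/
abbrev Dom (Z : Fin (a - 1) × Fin b → Bool) (i : Fin (a - 1)) : Type :=
  {x : Fin b // Z (i, x) = false}

/-- The partial functions given by injections from the sets `Dom Z i`. -/
def toMaps (Z : Fin (a - 1) × Fin b → Bool) (e : ∀ i, Dom Z i ↪ Fin b) : PartialMaps a b :=
  fun i x => if h : Z (i, x) = false then some (e i ⟨x, h⟩) else none

instance instNonemptyDom (Z : Fin (a - 1) × Fin b → Bool) (i : Fin (a - 1)) :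
    Nonempty (Dom Z i ↪ Fin b) := ⟨Function.Embedding.subtype _⟩

/-- Choose the domains of the `f_i`, keeping each element independently with probability `1 - p`;
then choose each `f_i` independently and uniformly among the injections from its domain. -/
noncomputable def maps (a b : ℕ) (p : unitInterval) : PMF (PartialMaps a b) :=
  (PMF.independent fun _ : Fin (a - 1) × Fin b => PMF.coin p).bind fun Z =>
    (PMF.independent fun i => PMF.uniformOfFintype (Dom Z i ↪ Fin b)).map (toMaps Z)

/-- With probability `q` a path stays uncoloured, otherwise it gets a uniformly random colour. -/
noncomputable def label (c : ℕ) [NeZero c] (q : unitInterval) : PMF (Option (Fin c)) :=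
  (PMF.coin q).bind fun e =>
    if e then PMF.pure none else (PMF.uniformOfFintype (Fin c)).map some

open Classical in
/-- The state of the path with first node `h`: the path that begins at node `0` of level `0` has no
colours, and the colours of all other paths are given by `κ`. -/
noncomputable def pathState {c : ℕ} (F : PartialMaps a b) (κ : F.Head → Option (Fin c))
    (h : F.Head) : PathState c :=
  if F.IsRoot h then .zero else
    match κ h with
    | none => .uncoloured
    | some z => .single z

open Classical in
/-- The state of the path on which `ν` is (if the `f_i` are partial injections, there is exactly one
such path). -/
noncomputable def nodeState {c : ℕ} (F : PartialMaps a b) (κ : F.Head → Option (Fin c))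
    (ν : Node a b) : PathState c :=
  if h : ∃ h : F.Head, F.OnPath h ν then pathState F κ h.choose else .uncoloured

/-- The restriction given by the functions `f_i` and the colours of the paths. -/
noncomputable def assemble {c : ℕ} (F : PartialMaps a b) (κ : F.Head → Option (Fin c)) :
    Restriction a b c
  | .f i x j => (F i x).map fun z => z.val.testBit j.val
  | .G i x y => (nodeState F κ (i, x)).colourValue y
  | .u x j =>
    if h : 0 < a then (nodeState F κ (⟨a - 1, Nat.sub_lt h one_pos⟩, x)).bitValue j else none

open Classical in
noncomputable instance instFintypeHead (F : PartialMaps a b) : Fintype F.Head :=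
  inferInstanceAs (Fintype {h : Node a b // F.IsHead h})

open Classical in
/-- The distribution `R_{p,q}` of random restrictions. -/
noncomputable def dist (a b c : ℕ) [NeZero c] (p q : unitInterval) : PMF (Restriction a b c) :=
  (maps a b p).bind fun F =>
    (PMF.independent fun _ : F.Head => label c q).map (assemble F)

end RandomRestriction

/-! ### Fixed precomputations -/

/-- In the situation of `Restriction.toOracle`, the restriction `ρ` fixes the precomputation `w` of
`M` on the inputs `x` and `v`, and the output of `w` is `z`: all replies YES in `w` are
correctly witnessed in `ρ`, and no query with reply NO in `w` has a witness in a legal extension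
of `ρ`. -/
def PNPMachine.Fixes (M : PNPMachine) {a b c : ℕ} (code : CPLSVar a b c ↪ List Bool)
    (rest : PartialOracle) (ρ : Restriction a b c)
    (w : List (List Bool × Option (List Bool))) (x v z : ℕ) : Prop :=
  M.IsPrecomputation (ρ.toOracle code rest) w x v z ∧
  ∀ q, (q, none) ∈ w → ∀ σ : Restriction a b c, σ.Legal → σ.Extends ρ →
    ∀ y, ¬ M.IsWitness (σ.toOracle code rest) q y

/-- `ρ ⊩ f_x(g_x(v)) = z`: the restriction `ρ` fixes a precomputation, with output `z`, of the
machine that first computes `u = g_x(v)` and then computes `f_x(u)`. Such a precomputation consists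
of a precomputation `w` of `g_x(v)` followed by a precomputation `w'` of `f_x(u)`. -/
def RetractionWPHP.Forces (P : RetractionWPHP) {a b c : ℕ} (code : CPLSVar a b c ↪ List Bool)
    (rest : PartialOracle) (ρ : Restriction a b c) (x v z : ℕ) : Prop :=
  ∃ (u : ℕ) (w w' : List (List Bool × Option (List Bool))),
    P.g.Fixes code rest ρ w x v u ∧ P.f.Fixes code rest ρ w' x u z

/-- `s` is (at most) quasipolynomial: `s(n) ≤ 2 ^ ((log n) ^ k)` for some `k` and all large `n`. -/
def QuasiPolynomial (s : ℕ → ℕ) : Prop :=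
  ∃ k : ℕ, ∀ᶠ n in atTop, s n ≤ 2 ^ (Nat.log 2 n) ^ k

/-! For a single argument `v < 2s`, computing `f_s(g_s(v))` is a decision tree of polylogarithmic
depth. Each query asks whether some term of a DNF of polylogarithmic width in the CPLS variables is
true. If `ρ` decides every query on the branch that it answers itself (some term is true in `ρ`, or
none is true in any legal extension), then `ρ` fixes a precomputation. A random `ρ` fails to do so
for a given `v` only with small probability `η`. By Markov's inequality, with probability at least
`1 - 2η` more than `s` of the `2s` arguments have fixed precomputations. Then two of them share a
value `u < s` of `g_s`, and the one fixed output of `f_s(u)` differs from at least one of the two.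

The bound on `η` comes from an encoding argument in the style of the switching lemma
(`exists_reach`, `exists_encoding`, `sum_weight_not_allOn_le`). Suppose that `ρ` leaves a query
undecided, and take the first such query. Let `t` be its least term that is true in some legal
extension of `ρ`. Extend `ρ` just enough to make `t` true, by defining values `f_i(x)` and colouring
paths; each such extension increases the probability by a factor of at least `1/ε`. The result `ρ'`
is legal and extends `ρ`, so `t` is also the least term true in `ρ'`, and all earlier queries keep
their answers. Hence `ρ` is recovered from `ρ'`, the index of the query, and one of three
instructions for each of at most `2r` positions, where `r` bounds the width. Summing weights bounds
the failures by `depth * ((1 + 2ε)^(2r) - 1)`.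

Two devices make the extensions reversible. Every node carries an independent label, of which only
those of first nodes of paths are visible; joining two paths therefore hides a label without losing
it. A path that belongs to the zero path of the target but is still detached from `(0,0)` cannot be
made zero; it gets a colour that `t` does not mention, which exists because `r < c`. The factor `ε`
for function values requires that few of them are undefined (`Dense`), and `maps_undefined_le` shows
that this holds with high probability. -/

open scoped ENNReal

/-! ### Decision trees -/

/-- Adaptive sequences of queries from `Q` with a final output in `O`. -/
inductive DecisionTree (Q O : Type) : Type
  | leaf : O → DecisionTree Q O
  | node : Q → (Bool → DecisionTree Q O) → DecisionTree Q O

namespace DecisionTree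

variable {Q Q' O O' : Type}

def depth : DecisionTree Q O → ℕ
  | leaf _ => 0
  | node _ k => max (k true).depth (k false).depth + 1

/-- The output if the replies are given by `ans`. -/
def eval (ans : Q → Bool) : DecisionTree Q O → O
  | leaf o => o
  | node q k => (k (ans q)).eval ans

/-- The `j`-th query if the replies are given by `ans`. -/
def query (ans : Q → Bool) : DecisionTree Q O → ℕ → Option Q
  | leaf _, _ => none
  | node q _, 0 => some q
  | node q k, j + 1 => (k (ans q)).query ans j

def bind : DecisionTree Q O → (O → DecisionTree Q O') → DecisionTree Q O'
  | leaf o, f => f o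
  | node q k, f => node q fun r => (k r).bind f

def map (g : Q → Q') : DecisionTree Q O → DecisionTree Q' O
  | leaf o => leaf o
  | node q k => node (g q) fun r => (k r).map g

/-- All queries occurring in the tree satisfy `P`. -/
def Forall (P : Q → Prop) : DecisionTree Q O → Prop
  | leaf _ => True
  | node q k => P q ∧ ∀ r, (k r).Forall P

/-- All queries on the branch given by `ans` satisfy `P`. -/
def AllOn (P : Q → Prop) (ans : Q → Bool) : DecisionTree Q O → Prop
  | leaf _ => True
  | node q k => P q ∧ (k (ans q)).AllOn P ans

theorem depth_map (g : Q → Q') (t : DecisionTree Q O) : (t.map g).depth = t.depth := by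
  induction t with
  | leaf o => rfl
  | node q k ih => simp [map, depth, ih]

theorem depth_bind_le (t : DecisionTree Q O) (f : O → DecisionTree Q O') (N : ℕ)
    (hf : ∀ o, (f o).depth ≤ N) : (t.bind f).depth ≤ t.depth + N := by
  induction t with
  | leaf o => simpa [bind, depth] using hf o
  | node q k ih =>
    have h1 := ih true
    have h2 := ih false
    simp only [bind, depth]
    omega

theorem Forall.bind {P : Q → Prop} {t : DecisionTree Q O} {f : O → DecisionTree Q O'}
    (ht : t.Forall P) (hf : ∀ o, (f o).Forall P) : (t.bind f).Forall P := by
  induction t with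
  | leaf o => exact hf o
  | node q k ih => exact ⟨ht.1, fun r => ih r (ht.2 r)⟩

theorem Forall.map {P : Q → Prop} {P' : Q' → Prop} {g : Q → Q'} {t : DecisionTree Q O}
    (ht : t.Forall P) (h : ∀ q, P q → P' (g q)) : (t.map g).Forall P' := by
  induction t with
  | leaf o => trivial
  | node q k ih => exact ⟨h q ht.1, fun r => ih r (ht.2 r)⟩

theorem Forall.query {P : Q → Prop} {t : DecisionTree Q O} (ht : t.Forall P) {ans : Q → Bool}
    {j : ℕ} {q : Q} (h : t.query ans j = some q) : P q := by
  induction t generalizing j with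
  | leaf o => simp [DecisionTree.query] at h
  | node q' k ih =>
    cases j with
    | zero =>
      obtain rfl : q' = q := by simpa [DecisionTree.query] using h
      exact ht.1
    | succ j => exact ih _ (ht.2 _) h

theorem allOn_bind {P : Q → Prop} {ans : Q → Bool} {t : DecisionTree Q O}
    {f : O → DecisionTree Q O'} :
    (t.bind f).AllOn P ans ↔ t.AllOn P ans ∧ (f (t.eval ans)).AllOn P ans := by
  induction t with
  | leaf o => simp [bind, AllOn, eval]
  | node q k ih => simp [bind, AllOn, eval, ih, and_assoc]

theorem allOn_map {P : Q' → Prop} {g : Q → Q'} {ans : Q' → Bool} {t : DecisionTree Q O} :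
    (t.map g).AllOn P ans ↔ t.AllOn (fun q => P (g q)) (fun q => ans (g q)) := by
  induction t with
  | leaf o => simp [map, AllOn]
  | node q k ih => simp [map, AllOn, ih]

theorem eval_map {g : Q → Q'} {ans : Q' → Bool} {t : DecisionTree Q O} :
    (t.map g).eval ans = t.eval fun q => ans (g q) := by
  induction t with
  | leaf o => rfl
  | node q k ih => simp [map, eval, ih]

theorem exists_first_failure {P : Q → Prop} {ans : Q → Bool} {t : DecisionTree Q O}
    (h : ¬ t.AllOn P ans) :
    ∃ j < t.depth, ∃ q, t.query ans j = some q ∧ ¬ P q ∧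
      ∀ i < j, ∀ q', t.query ans i = some q' → P q' := by
  induction t with
  | leaf o => exact absurd trivial h
  | node q k ih =>
    by_cases hq : P q
    · obtain ⟨j, hj, q₁, h1, h2, h3⟩ := ih (ans q) fun h' => h ⟨hq, h'⟩
      refine ⟨j + 1, ?_, q₁, h1, h2, fun i hi q' hq' => ?_⟩
      · simp only [depth]
        cases hr : ans q <;> rw [hr] at hj <;> omega
      · cases i with
        | zero =>
          obtain rfl : q = q' := by simpa [DecisionTree.query] using hq'
          exact hq
        | succ i => exact h3 i (by omega) q' hq'
    · exact ⟨0, by simp [depth], q, rfl, hq, fun i hi => absurd hi (by omega)⟩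

/-- Used with a restriction and an extension of it: if all earlier queries are decided, both follow
the same branch, so the extension reveals which query was the first undecided one. -/
theorem query_congr {ans ans' : Q → Bool} {t : DecisionTree Q O} {j : ℕ}
    (h : ∀ i < j, ∀ q, t.query ans i = some q → ans' q = ans q) :
    t.query ans' j = t.query ans j := by
  induction t generalizing j with
  | leaf o => rfl
  | node q k ih =>
    cases j with
    | zero => rfl
    | succ j =>
      simp only [query]
      rw [h 0 (by omega) q rfl]
      exact ih _ fun i hi q' hq' => h (i + 1) (by omega) q' hq'

end DecisionTree

/-! ### The decision trees of oracle machines -/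

namespace OracleMachine

variable (M : OracleMachine)

/-- The first `t` steps of the machine as a decision tree. -/
def tree : ℕ → M.Config → DecisionTree (List Bool) M.Config
  | 0, c => .leaf c
  | t + 1, c =>
    match M.step c with
    | .halted => .leaf c
    | .next c' => tree t c'
    | .asks q k => .node q fun r => tree t (k r)

variable {M}

theorem depth_tree_le (t : ℕ) (c : M.Config) : (M.tree t c).depth ≤ t := by
  induction t generalizing c with
  | zero => simp [tree, DecisionTree.depth]
  | succ t ih =>
    rw [tree]
    cases M.step c with
    | halted => simp [DecisionTree.depth]
    | next c' => exact (ih c').trans (Nat.le_succ t)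
    | asks q k =>
      have h1 := ih (k true)
      have h2 := ih (k false)
      simp only [DecisionTree.depth]
      omega

theorem StackOp.length_apply_le (o : StackOp) (l : List Bool) :
    (o.apply l).length ≤ l.length + 1 := by
  cases o <;> simp [StackOp.apply]
  omega

theorem query_length_of_next {c c' : M.Config} (h : M.step c = .next c') :
    (c'.stack .query).length ≤ (c.stack .query).length + 1 := by
  unfold step at h
  split at h
  · simp at h
  · injection h with h
    subst h
    exact StackOp.length_apply_le _ _
  · simp at h

theorem query_of_asks {c : M.Config} {q : List Bool} {k : Bool → M.Config}
    (h : M.step c = .asks q k) : q = c.stack .query ∧ ∀ r, (k r).stack = c.stack := by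
  unfold step at h
  split at h
  · simp at h
  · simp at h
  · injection h with h1 h2
    subst h1 h2
    exact ⟨rfl, fun _ => rfl⟩

/-- One step pushes at most one bit onto the query stack, so the running time bounds the length of
the queries. -/
theorem forall_tree_length_le (N t : ℕ) (c : M.Config) (h : (c.stack .query).length + t ≤ N) :
    (M.tree t c).Forall fun q => q.length ≤ N := by
  induction t generalizing c with
  | zero => trivial
  | succ t ih =>
    rw [tree]
    cases hs : M.step c with
    | halted => trivial
    | next c' =>
      have := query_length_of_next hs
      exact ih c' (by omega)
    | asks q k =>
      obtain ⟨h1, h2⟩ := query_of_asks hs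
      exact ⟨by rw [h1]; omega, fun r => ih (k r) (by rw [h2]; omega)⟩

theorem HaltsWithin.length_le {t : ℕ} {c d : M.Config} {l : List (List Bool × Bool)}
    (ht : M.HaltsWithin t c) (h : M.Run c l d) : l.length ≤ t := by
  induction t generalizing c l with
  | zero =>
    cases h with
    | halted _ => simp
    | next hs _ => rw [HaltsWithin, hs] at ht; simp at ht
    | asks hs _ => rw [HaltsWithin, hs] at ht; simp at ht
  | succ t ih =>
    cases h with
    | halted _ => simp
    | next hs h => rw [HaltsWithin, hs] at ht; exact (ih ht h).trans (Nat.le_succ t)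
    | asks hs h => rw [HaltsWithin, hs] at ht; simpa using ih (ht _) h

/-- The replies depend on the query alone, so a branch of the tree can be read as a precomputation
with witnesses from `W`. Halting within `t` steps ensures that the leaf is a halting configuration
and not a cut-off. -/
theorem HaltsWithin.exists_run {t : ℕ} {c : M.Config} (ht : M.HaltsWithin t c)
    {P : List Bool → Prop} (W : List Bool → Option (List Bool))
    (h : (M.tree t c).AllOn P fun q => (W q).isSome) :
    ∃ w : List (List Bool × Option (List Bool)),
      M.Run c (w.map fun e => (e.1, e.2.isSome)) ((M.tree t c).eval fun q => (W q).isSome) ∧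
        ∀ e ∈ w, e.2 = W e.1 ∧ P e.1 := by
  induction t generalizing c with
  | zero => exact ⟨[], .halted ht, by simp⟩
  | succ t ih =>
    rw [HaltsWithin] at ht
    rw [tree] at h ⊢
    cases hs : M.step c with
    | halted => exact ⟨[], .halted hs, by simp⟩
    | next c' =>
      rw [hs] at ht h
      obtain ⟨w, h1, h2⟩ := ih ht h
      exact ⟨w, .next hs h1, h2⟩
    | asks q k =>
      rw [hs] at ht h
      obtain ⟨w, h1, h2⟩ := ih (ht _) h.2
      refine ⟨(q, W q) :: w, .asks hs h1, fun e he => ?_⟩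
      rcases List.mem_cons.1 he with rfl | he
      · exact ⟨rfl, h.1⟩
      · exact h2 e he

end OracleMachine

theorem eval_nat_mono (p : Polynomial ℕ) : Monotone fun x => p.eval x := by
  intro x y h
  simp only [Polynomial.eval_eq_sum_range]
  gcongr

/-! ### Queries as disjunctions of terms -/

section Terms

variable {a b c : ℕ}

/-- The restriction makes all literals of the term true. -/
def Restriction.SatTerm (ρ : Restriction a b c) (t : List (CPLSVar a b c × Bool)) : Prop :=
  ∀ e ∈ t, ρ e.1 = some e.2

/-- The restriction makes some term true. -/
def Restriction.Sat (ρ : Restriction a b c) (D : Set (List (CPLSVar a b c × Bool))) : Prop :=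
  ∃ t ∈ D, ρ.SatTerm t

/-- The query is decided by `ρ`: it has a true term, or no legal extension makes a term true. -/
def Restriction.Decides (ρ : Restriction a b c) (D : Set (List (CPLSVar a b c × Bool))) : Prop :=
  ρ.Sat D ∨ ∀ σ : Restriction a b c, σ.Legal → σ.Extends ρ → ¬ σ.Sat D

theorem Restriction.Extends.satTerm {σ ρ : Restriction a b c} (h : σ.Extends ρ)
    {t : List (CPLSVar a b c × Bool)} (ht : ρ.SatTerm t) : σ.SatTerm t :=
  fun e he => h _ _ (ht e he)

theorem Restriction.toOracle_code (code : CPLSVar a b c ↪ List Bool) (rest : PartialOracle)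
    (ρ : Restriction a b c) (v : CPLSVar a b c) : ρ.toOracle code rest (code v) = ρ v := by
  have h : ∃ w, code w = code v := ⟨v, rfl⟩
  rw [Restriction.toOracle, dif_pos h, code.injective h.choose_spec]

theorem Restriction.toOracle_of_notMem (code : CPLSVar a b c ↪ List Bool) (rest : PartialOracle)
    (ρ : Restriction a b c) {s : List Bool} (h : s ∉ Set.range code) :
    ρ.toOracle code rest s = rest s := dif_neg h

open Classical in
/-- The literal about a variable that corresponds to a reply of the oracle, if any. -/
noncomputable def decodeLiteral (code : CPLSVar a b c ↪ List Bool) (e : List Bool × Bool) :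
    Option (CPLSVar a b c × Bool) :=
  if h : ∃ v, code v = e.1 then some (h.choose, e.2) else none

theorem decodeLiteral_code (code : CPLSVar a b c ↪ List Bool) (v : CPLSVar a b c) (r : Bool) :
    decodeLiteral code (code v, r) = some (v, r) := by
  have h : ∃ w, code w = code v := ⟨v, rfl⟩
  rw [decodeLiteral, dif_pos h, code.injective h.choose_spec]

theorem code_of_decodeLiteral {code : CPLSVar a b c ↪ List Bool} {e : List Bool × Bool}
    {e' : CPLSVar a b c × Bool} (h : decodeLiteral code e = some e') : e = (code e'.1, e'.2) := by
  unfold decodeLiteral at h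
  split at h
  case isTrue h' =>
    injection h with h
    subst h
    exact Prod.ext h'.choose_spec.symm rfl
  case isFalse h' => simp at h

/-- The disjunction of terms that expresses that a query has a witness. -/
def PNPMachine.terms (M : PNPMachine) (code : CPLSVar a b c ↪ List Bool) (rest : PartialOracle)
    (q : List Bool) : Set (List (CPLSVar a b c × Bool)) :=
  {t | ∃ (y : List Bool) (l : List (List Bool × Bool)) (d : M.verifier.Config),
    y.length ≤ M.witnessBound.eval q.length ∧ M.verifier.Run (M.verifier.init q y) l d ∧
    (d.stack .output).head? = some true ∧ (∀ e ∈ l, e.1 ∉ Set.range code → rest e.1 = some e.2) ∧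
    t = l.filterMap (decodeLiteral code)}

/-- An accepting run reads finitely many bits. Those at positions of variables become the literals
of a term; the others do not depend on `ρ` and are checked against `rest` beforehand. Runs with
contradictory replies only contribute terms that are never true. -/
theorem PNPMachine.sat_terms_iff (M : PNPMachine) (code : CPLSVar a b c ↪ List Bool)
    (rest : PartialOracle) (ρ : Restriction a b c) (q : List Bool) :
    ρ.Sat (M.terms code rest q) ↔ ∃ y, M.IsWitness (ρ.toOracle code rest) q y := by
  constructor
  · rintro ⟨t, ⟨y, l, d, hy, hrun, hd, hl, rfl⟩, ht⟩
    refine ⟨y, hy, l, d, hrun, fun e he => ?_, hd⟩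
    by_cases h : e.1 ∈ Set.range code
    · obtain ⟨v, hv⟩ := h
      have h1 : decodeLiteral code e = some (v, e.2) := by
        rw [← decodeLiteral_code code v e.2, hv]
      rw [← hv, Restriction.toOracle_code]
      exact ht (v, e.2) (List.mem_filterMap.2 ⟨e, he, h1⟩)
    · rw [Restriction.toOracle_of_notMem code rest ρ h]
      exact hl e he h
  · rintro ⟨y, hy, l, d, hrun, hl, hd⟩
    refine ⟨_, ⟨y, l, d, hy, hrun, hd, fun e he h => ?_, rfl⟩, fun e he => ?_⟩
    · rw [← hl e he, Restriction.toOracle_of_notMem code rest ρ h]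
    · obtain ⟨e', he', h'⟩ := List.mem_filterMap.1 he
      have := hl e' he'
      rwa [code_of_decodeLiteral h', Restriction.toOracle_code] at this

theorem PNPMachine.length_le_of_mem_terms (M : PNPMachine) (code : CPLSVar a b c ↪ List Bool)
    (rest : PartialOracle) {q : List Bool} {t : List (CPLSVar a b c × Bool)} {p : Polynomial ℕ}
    (hp : ∀ a b : List Bool,
      M.verifier.HaltsWithin (p.eval (a.length + b.length)) (M.verifier.init a b))
    {N : ℕ} (hq : q.length ≤ N) (ht : t ∈ M.terms code rest q) :
    t.length ≤ p.eval (N + M.witnessBound.eval N) := by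
  obtain ⟨y, l, d, hy, hrun, -, -, rfl⟩ := ht
  refine (List.length_filterMap_le _ _).trans (((hp q y).length_le hrun).trans ?_)
  exact eval_nat_mono p (add_le_add hq (hy.trans (eval_nat_mono _ hq)))

theorem PNPMachine.fixes_of_allOn (M : PNPMachine) (code : CPLSVar a b c ↪ List Bool)
    (rest : PartialOracle) (ρ : Restriction a b c) (x v t : ℕ)
    (ht : M.base.HaltsWithin t (M.base.init (Nat.bits x) (Nat.bits v)))
    {ans : List Bool → Bool} (hans : ∀ q, ans q = true ↔ ρ.Sat (M.terms code rest q))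
    (h : (M.base.tree t (M.base.init (Nat.bits x) (Nat.bits v))).AllOn
      (fun q => ρ.Decides (M.terms code rest q)) ans) :
    ∃ w, M.Fixes code rest ρ w x v (natOfBits
      (((M.base.tree t (M.base.init (Nat.bits x) (Nat.bits v))).eval ans).stack .output)) := by
  classical
  let W : List Bool → Option (List Bool) := fun q =>
    if h : ∃ y, M.IsWitness (ρ.toOracle code rest) q y then some h.choose else none
  have hW : ans = fun q => (W q).isSome := by
    funext q
    rw [Bool.eq_iff_iff, hans, M.sat_terms_iff]
    simp only [W]
    split <;> rename_i h' <;> simpa using h'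
  subst hW
  obtain ⟨w, h1, h2⟩ := ht.exists_run W h
  refine ⟨w, ⟨⟨_, h1, rfl⟩, fun q y hqy => ?_⟩, fun q hq σ hσ hext y hy => ?_⟩
  · have := (h2 _ hqy).1
    simp only [W] at this
    split at this
    case isTrue h' =>
      injection this with this
      rw [this]
      exact h'.choose_spec
    case isFalse h' => simp at this
  · obtain ⟨h3, h4⟩ := h2 _ hq
    -- The reply NO excludes a term true in `ρ`, so being decided means that no legal extension has
    -- a witness.
    rcases h4 with h4 | h4
    · rw [← hans] at h4
      simp only [← h3] at h4
      simp at h4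
    · exact h4 σ hσ hext ((M.sat_terms_iff code rest σ q).2 ⟨y, hy⟩)

end Terms

/-! ### Paths and their first nodes -/

namespace PartialMaps

variable {a b : ℕ}

/-- The node `(i, x)` as a possible start of an edge. -/
def src (i : Fin (a - 1)) (x : Fin b) : Node a b := (⟨i.val, by omega⟩, x)

/-- The node `(i + 1, z)`. -/
def tgt (i : Fin (a - 1)) (z : Fin b) : Node a b := (⟨i.val + 1, by omega⟩, z)

theorem edge_iff {F : PartialMaps a b} {ν μ : Node a b} :
    F.Edge ν μ ↔ ∃ i x z, ν = src i x ∧ μ = tgt i z ∧ F i x = some z := by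
  constructor
  · rintro ⟨i, h1, h2, h3⟩
    exact ⟨i, ν.2, μ.2, Prod.ext (Fin.ext h1) rfl, Prod.ext (Fin.ext h2) rfl, h3⟩
  · rintro ⟨i, x, z, rfl, rfl, h⟩
    exact ⟨i, rfl, rfl, h⟩

theorem tgt_injective {i i' : Fin (a - 1)} {x x' : Fin b} (h : tgt i x = tgt i' x') :
    i = i' ∧ x = x' := by
  simpa [tgt, Fin.ext_iff] using h

/-- The family `F'` extends `F`. -/
def Le (F F' : PartialMaps a b) : Prop := ∀ i x z, F i x = some z → F' i x = some z

theorem Le.injective {F F' : PartialMaps a b} (h : F.Le F') (hF : F'.Injective) : F.Injective :=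
  fun i x x' z h1 h2 => hF i x x' z (h _ _ _ h1) (h _ _ _ h2)

theorem Le.edge {F F' : PartialMaps a b} (h : F.Le F') {ν μ : Node a b} (hF : F.Edge ν μ) :
    F'.Edge ν μ := by
  obtain ⟨i, h1, h2, h3⟩ := hF
  exact ⟨i, h1, h2, h _ _ _ h3⟩

theorem Le.reflTransGen {F F' : PartialMaps a b} (h : F.Le F') {ν μ : Node a b}
    (hF : Relation.ReflTransGen F.Edge ν μ) : Relation.ReflTransGen F'.Edge ν μ :=
  Relation.ReflTransGen.mono (fun _ _ => h.edge) _ _ hF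

theorem Injective.edge_unique {F : PartialMaps a b} (hF : F.Injective) {ν ν' μ : Node a b}
    (h : F.Edge ν μ) (h' : F.Edge ν' μ) : ν = ν' := by
  obtain ⟨i, x, z, rfl, rfl, hx⟩ := edge_iff.1 h
  obtain ⟨i', x', z', rfl, h1, hx'⟩ := edge_iff.1 h'
  obtain ⟨rfl, rfl⟩ := tgt_injective h1
  rw [hF i x x' z hx hx']

theorem level_le {F : PartialMaps a b} {ν μ : Node a b} (h : Relation.ReflTransGen F.Edge ν μ) :
    ν.1.val ≤ μ.1.val := by
  induction h with
  | refl => exact le_rfl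
  | tail _ h ih =>
    obtain ⟨i, h1, h2, -⟩ := h
    omega

theorem exists_isHead (F : PartialMaps a b) (ν : Node a b) :
    ∃ h, F.IsHead h ∧ Relation.ReflTransGen F.Edge h ν := by
  induction hn : ν.1.val using Nat.strong_induction_on generalizing ν with
  | _ n ih =>
    by_cases h : F.IsHead ν
    · exact ⟨ν, h, .refl⟩
    · obtain ⟨μ, hμ⟩ := not_forall_not.1 h
      obtain ⟨i, h1, h2, -⟩ := id hμ
      obtain ⟨h, hh, hh'⟩ := ih μ.1.val (by omega) μ rfl
      exact ⟨h, hh, hh'.tail hμ⟩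

/-- Injectivity makes the walk backwards from `ν` unique, and it can stop only at a node without
predecessor. -/
theorem Injective.head_unique {F : PartialMaps a b} (hF : F.Injective) {h h' ν : Node a b}
    (hh : F.IsHead h) (hh' : F.IsHead h') (hν : Relation.ReflTransGen F.Edge h ν)
    (hν' : Relation.ReflTransGen F.Edge h' ν) : h = h' := by
  induction hν with
  | refl =>
    cases hν' with
    | refl => rfl
    | tail _ he => exact absurd he (hh _)
  | tail hν he ih =>
    rcases Relation.ReflTransGen.cases_tail hν' with hν' | ⟨μ, hμ, he'⟩
    · rw [hν'] at he
      exact absurd he (hh' _)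
    · rw [hF.edge_unique he' he] at hμ
      exact ih hμ

/-- The first node of a path on which `ν` is. -/
noncomputable def headOf (F : PartialMaps a b) (ν : Node a b) : Node a b :=
  (F.exists_isHead ν).choose

theorem isHead_headOf (F : PartialMaps a b) (ν : Node a b) : F.IsHead (F.headOf ν) :=
  (F.exists_isHead ν).choose_spec.1

theorem headOf_path (F : PartialMaps a b) (ν : Node a b) :
    Relation.ReflTransGen F.Edge (F.headOf ν) ν :=
  (F.exists_isHead ν).choose_spec.2

theorem Injective.headOf_eq {F : PartialMaps a b} (hF : F.Injective) {h ν : Node a b}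
    (hh : F.IsHead h) (hν : Relation.ReflTransGen F.Edge h ν) : F.headOf ν = h :=
  hF.head_unique (F.isHead_headOf ν) hh (F.headOf_path ν) hν

theorem Injective.headOf_congr {F : PartialMaps a b} (hF : F.Injective) {ν μ : Node a b}
    (h : Relation.ReflTransGen F.Edge ν μ) : F.headOf μ = F.headOf ν :=
  hF.headOf_eq (F.isHead_headOf ν) ((F.headOf_path ν).trans h)

/-- The family with `f_i(x)` changed to `z`. -/
def set (F : PartialMaps a b) (i : Fin (a - 1)) (x : Fin b) (z : Option (Fin b)) :
    PartialMaps a b :=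
  Function.update F i (Function.update (F i) x z)

theorem set_apply (F : PartialMaps a b) (i i' : Fin (a - 1)) (x x' : Fin b) (z : Option (Fin b)) :
    F.set i x z i' x' = if i' = i ∧ x' = x then z else F i' x' := by
  unfold set
  by_cases hi : i' = i
  · subst hi
    by_cases hx : x' = x
    · subst hx; simp
    · simp [hx]
  · simp [hi]

theorem set_self (F : PartialMaps a b) (i : Fin (a - 1)) (x : Fin b) (z : Option (Fin b)) :
    F.set i x z i x = z := by simp [set_apply]

theorem set_set_none {F : PartialMaps a b} {i : Fin (a - 1)} {x : Fin b} (h : F i x = none)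
    (z : Option (Fin b)) : (F.set i x z).set i x none = F := by
  funext i' x'
  simp only [set_apply]
  split_ifs with h1
  · rw [h1.1, h1.2, h]
  · rfl

theorem le_set {F : PartialMaps a b} {i : Fin (a - 1)} {x : Fin b} (h : F i x = none)
    (z : Option (Fin b)) : F.Le (F.set i x z) := by
  intro i' x' z' h'
  rw [set_apply, if_neg]
  · exact h'
  · rintro ⟨rfl, rfl⟩
    rw [h] at h'
    simp at h'

theorem edge_set_iff {F : PartialMaps a b} {i : Fin (a - 1)} {x z : Fin b} (h : F i x = none)
    {ν μ : Node a b} :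
    (F.set i x (some z)).Edge ν μ ↔ F.Edge ν μ ∨ ν = src i x ∧ μ = tgt i z := by
  constructor
  · intro he
    obtain ⟨i', x', z', rfl, rfl, h'⟩ := edge_iff.1 he
    rw [set_apply] at h'
    split_ifs at h' with h1
    · obtain ⟨rfl, rfl⟩ := h1
      injection h' with h'
      subst h'
      exact .inr ⟨rfl, rfl⟩
    · exact .inl (edge_iff.2 ⟨i', x', z', rfl, rfl, h'⟩)
  · rintro (he | ⟨rfl, rfl⟩)
    · exact (le_set h _).edge he
    · exact edge_iff.2 ⟨i, x, z, rfl, rfl, set_self _ _ _ _⟩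

theorem isHead_tgt_of_set {F : PartialMaps a b} {i : Fin (a - 1)} {x z : Fin b} (h : F i x = none)
    (hF : (F.set i x (some z)).Injective) : F.IsHead (tgt i z) := by
  intro ν hν
  obtain ⟨i', x', z', rfl, h1, h2⟩ := edge_iff.1 hν
  obtain ⟨rfl, rfl⟩ := tgt_injective h1
  have := hF i x' x z (le_set h _ _ _ _ h2) (set_self _ _ _ _)
  rw [this, h] at h2
  simp at h2

theorem headOf_src_ne_tgt (F : PartialMaps a b) (i : Fin (a - 1)) (x z : Fin b) :
    F.headOf (src i x) ≠ tgt i z := by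
  intro h
  have := level_le (F.headOf_path (src i x))
  rw [h] at this
  simp [src, tgt] at this

/-- The new edge attaches the path that begins at `tgt i z` to the path through `src i x`. These
paths are distinct because levels increase along edges, and only nodes of the former get a new first
node. -/
theorem headOf_set {F : PartialMaps a b} {i : Fin (a - 1)} {x z : Fin b} (h : F i x = none)
    (hF : (F.set i x (some z)).Injective) (ν : Node a b) :
    (F.set i x (some z)).headOf ν =
      if F.headOf ν = tgt i z then F.headOf (src i x) else F.headOf ν := by
  have hle : F.Le (F.set i x (some z)) := le_set h _
  have key : ∀ μ : Node a b, F.IsHead μ → μ ≠ tgt i z → (F.set i x (some z)).IsHead μ := by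
    intro μ hμ hne ν hν
    rcases (edge_set_iff h).1 hν with hν | ⟨-, hν⟩
    · exact hμ ν hν
    · exact hne hν
  split_ifs with h1
  · refine hF.headOf_eq (key _ (F.isHead_headOf _) (F.headOf_src_ne_tgt i x z)) ?_
    refine (hle.reflTransGen (F.headOf_path _)).trans (.head ((edge_set_iff h).2
      (.inr ⟨rfl, rfl⟩)) ?_)
    rw [← h1]
    exact hle.reflTransGen (F.headOf_path ν)
  · exact hF.headOf_eq (key _ (F.isHead_headOf _) h1) (hle.reflTransGen (F.headOf_path ν))

end PartialMaps

/-! ### The restriction given by partial maps and labels -/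

/-- A family of partial functions and a label for every node, of which only those of the first nodes
of paths matter. -/
abbrev LabelledMaps (a b c : ℕ) : Type := PartialMaps a b × (Node a b → Option (Fin c))

namespace LabelledMaps

open PartialMaps

variable {a b c : ℕ}

open Classical in
/-- The state of a path with first node `h`. -/
noncomputable def headState (κ : Node a b → Option (Fin c)) (h : Node a b) : PathState c :=
  if h.1.val = 0 ∧ h.2.val = 0 then .zero else
    match κ h with
    | none => .uncoloured
    | some z => .single z

/-- The state of the path on which a node is. -/
noncomputable def state (S : LabelledMaps a b c) (ν : Node a b) : PathState c :=
  headState S.2 (S.1.headOf ν)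

/-- The restriction given by the maps and the labels of the first nodes. -/
noncomputable def restriction (S : LabelledMaps a b c) : Restriction a b c :=
  RandomRestriction.assemble S.1 fun h => S.2 h.1

theorem pathState_eq (F : PartialMaps a b) (κ : Node a b → Option (Fin c)) (h : F.Head) :
    RandomRestriction.pathState F (fun h => κ h.1) h = headState κ h.1 := by
  unfold RandomRestriction.pathState headState PartialMaps.IsRoot
  congr

theorem nodeState_eq {S : LabelledMaps a b c} (hS : S.1.Injective) (ν : Node a b) :
    RandomRestriction.nodeState S.1 (fun h => S.2 h.1) ν = S.state ν := by
  have h : ∃ h : S.1.Head, S.1.OnPath h ν :=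
    ⟨⟨S.1.headOf ν, S.1.isHead_headOf ν⟩, S.1.headOf_path ν⟩
  rw [RandomRestriction.nodeState, dif_pos h, pathState_eq, state,
    hS.headOf_eq h.choose.2 h.choose_spec]

theorem restriction_f (S : LabelledMaps a b c) (i : Fin (a - 1)) (x : Fin b)
    (j : Fin (Nat.log 2 b)) :
    S.restriction (.f i x j) = (S.1 i x).map fun z => z.val.testBit j.val := rfl

theorem restriction_G {S : LabelledMaps a b c} (hS : S.1.Injective) (i : Fin a) (x : Fin b)
    (y : Fin c) : S.restriction (.G i x y) = (S.state (i, x)).colourValue y := by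
  rw [← nodeState_eq hS]
  rfl

theorem restriction_u {S : LabelledMaps a b c} (hS : S.1.Injective) (ha : 0 < a) (x : Fin b)
    (j : Fin (Nat.log 2 c)) :
    S.restriction (.u x j) = (S.state (⟨a - 1, Nat.sub_lt ha one_pos⟩, x)).bitValue j := by
  rw [← nodeState_eq hS]
  exact dif_pos ha

theorem headState_eq_uncoloured {κ : Node a b → Option (Fin c)} {h : Node a b} :
    headState κ h = .uncoloured ↔ ¬ (h.1.val = 0 ∧ h.2.val = 0) ∧ κ h = none := by
  unfold headState
  split_ifs with h1
  · simp [h1]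
  · cases κ h <;> simp [h1]

theorem legal_restriction {S : LabelledMaps a b c} (hS : S.1.Injective) : S.restriction.Legal := by
  refine ⟨S.1, hS, fun i x j => rfl, fun h => ⟨headState S.2 h.1, ?_, fun ν hν => ?_⟩⟩
  · unfold PartialMaps.IsRoot headState
    split_ifs with h1
    · exact .inr (.inl ⟨rfl, h1⟩)
    · cases S.2 h.1 with
      | none => exact .inl rfl
      | some z => exact .inr (.inr ⟨⟨z, rfl⟩, h1⟩)
  · have hs : S.state ν = headState S.2 h.1 := by rw [state, hS.headOf_eq h.2 hν]
    refine ⟨fun y => by rw [restriction_G hS, hs], fun ha j => ?_⟩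
    have hν' : ν = (⟨a - 1, Nat.sub_lt (by omega) one_pos⟩, ν.2) :=
      Prod.ext (Fin.ext (Nat.eq_sub_of_add_eq ha)) rfl
    rw [restriction_u hS (by omega), ← hs, ← hν']

/-- Every node has a state which is refined by the one in `S'`. -/
def Refines (S' S : LabelledMaps a b c) : Prop :=
  S.1.Le S'.1 ∧ ∀ ν, S.state ν = .uncoloured ∨ S'.state ν = S.state ν

theorem Refines.refl (S : LabelledMaps a b c) : S.Refines S :=
  ⟨fun _ _ _ h => h, fun _ => .inr rfl⟩

theorem Refines.trans {S S' S'' : LabelledMaps a b c} (h' : S''.Refines S') (h : S'.Refines S) :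
    S''.Refines S := by
  refine ⟨fun i x z hz => h'.1 i x z (h.1 i x z hz), fun ν => ?_⟩
  rcases h.2 ν with h1 | h1
  · exact .inl h1
  · rcases h'.2 ν with h2 | h2
    · exact .inl (h1 ▸ h2)
    · exact .inr (h2.trans h1)

theorem Refines.extends {S S' : LabelledMaps a b c} (h : S'.Refines S) (hS : S'.1.Injective) :
    S'.restriction.Extends S.restriction := by
  have hS0 := h.1.injective hS
  intro v e hv
  cases v with
  | f i x j =>
    rw [restriction_f] at hv ⊢
    cases hz : S.1 i x with
    | none => rw [hz] at hv; simp at hv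
    | some z => rw [hz] at hv; rwa [h.1 i x z hz]
  | G i x y =>
    rw [restriction_G hS0] at hv
    rw [restriction_G hS]
    rcases h.2 (i, x) with h1 | h1
    · rw [h1] at hv; simp [PathState.colourValue] at hv
    · rwa [h1]
  | u x j =>
    by_cases ha : 0 < a
    · rw [restriction_u hS0 ha] at hv
      rw [restriction_u hS ha]
      rcases h.2 (⟨a - 1, Nat.sub_lt ha one_pos⟩, x) with h1 | h1
      · rw [h1] at hv; simp [PathState.bitValue] at hv
      · rwa [h1]
    · have : S.restriction (.u x j) = none := dif_neg ha
      rw [this] at hv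
      simp at hv

end LabelledMaps

namespace LabelledMaps

open PartialMaps

variable {a b c : ℕ}

/-! ### Undoing extensions of labelled maps -/

/-- The node on whose path a variable `G_i(x, y)` or `u(x)` is; `f_i(x)` is assigned to `(i, x)`. -/
def site (ha : 0 < a) : CPLSVar a b c → Node a b
  | .f i x _ => src i x
  | .G i x _ => (i, x)
  | .u x _ => (⟨a - 1, Nat.sub_lt ha one_pos⟩, x)

/-- Undo one extension at a variable: do nothing, or make `f_i(x)` undefined and possibly exchange
the labels of the two resulting paths, or make a path uncoloured. -/
noncomputable def undo (ha : 0 < a) (v : CPLSVar a b c) (o : Option Bool)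
    (S : LabelledMaps a b c) : LabelledMaps a b c :=
  match v, o with
  | _, none => S
  | .f i x _, some false => (S.1.set i x none, S.2)
  | .f i x _, some true =>
    (S.1.set i x none, fun ν => match S.1 i x with
      | none => S.2 ν
      | some z => S.2 (Equiv.swap (S.1.headOf (src i x)) (tgt i z) ν))
  | v, some _ => (S.1, Function.update S.2 (S.1.headOf (site ha v)) none)

/-- Undo extensions at all variables in the list, the last one first. -/
noncomputable def undoAll (ha : 0 < a) :
    List (CPLSVar a b c) → (ℕ → Option Bool) → LabelledMaps a b c → LabelledMaps a b c
  | [], _, S => S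
  | v :: L, o, S => undo ha v (o 0) (undoAll ha L (fun k => o (k + 1)) S)

theorem undo_none (ha : 0 < a) (v : CPLSVar a b c) (S : LabelledMaps a b c) :
    undo ha v none S = S := by
  cases v <;> rfl

theorem undoAll_none (ha : 0 < a) (L : List (CPLSVar a b c)) (S : LabelledMaps a b c) :
    undoAll ha L (fun _ => none) S = S := by
  induction L with
  | nil => rfl
  | cons v L ih => rw [undoAll, ih, undo_none]

theorem undoAll_congr (ha : 0 < a) {L : List (CPLSVar a b c)} {o o' : ℕ → Option Bool}
    (h : ∀ k < L.length, o k = o' k) (S : LabelledMaps a b c) :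
    undoAll ha L o S = undoAll ha L o' S := by
  induction L generalizing o o' with
  | nil => rfl
  | cons v L ih =>
    rw [undoAll, undoAll, h 0 (by simp), ih fun k hk => h (k + 1) (by simpa using hk)]

theorem undoAll_append (ha : 0 < a) (L L' : List (CPLSVar a b c)) (o : ℕ → Option Bool)
    (S : LabelledMaps a b c) :
    undoAll ha (L ++ L') o S = undoAll ha L o (undoAll ha L' (fun k => o (k + L.length)) S) := by
  induction L generalizing o with
  | nil => rfl
  | cons v L ih => simp only [List.cons_append, undoAll, ih, List.length_cons, add_assoc]

/-- The factor by which an extension that has to be undone increases the weight. -/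
def undoWeight (ε : ℝ≥0∞) (o : Option Bool) : ℝ≥0∞ := if o.isSome then ε else 1

/-- Weights of labelled maps under which the labels are independent, and such that defining one more
value of a function, as well as colouring a path, increases the weight by the factor `ε⁻¹`. -/
structure Weighting (a b c K : ℕ) (ε : ℝ≥0∞) where
  maps : PartialMaps a b → ℝ≥0∞
  label : Option (Fin c) → ℝ≥0∞
  maps_le : ∀ (F : PartialMaps a b) (i : Fin (a - 1)) (x z : Fin b), F i x = none →
    (F.set i x (some z)).Injective → (Finset.univ.filter fun x => F i x = none).card ≤ K →
    maps F ≤ ε * maps (F.set i x (some z))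
  label_le : ∀ z, label none ≤ ε * label (some z)

variable {K : ℕ} {ε : ℝ≥0∞} (W : Weighting a b c K ε)

/-- The weight of labelled maps. -/
noncomputable def Weighting.weight (S : LabelledMaps a b c) : ℝ≥0∞ :=
  W.maps S.1 * ∏ ν, W.label (S.2 ν)

/-- `S` is obtained from `S'` by undoing extensions at the variables in the list. -/
def Weighting.Reach (ha : 0 < a) (L : List (CPLSVar a b c)) (S S' : LabelledMaps a b c) : Prop :=
  ∃ o : ℕ → Option Bool, S = undoAll ha L o S' ∧
    W.weight S ≤ (∏ k ∈ Finset.range L.length, undoWeight ε (o k)) * W.weight S'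

variable {W}

theorem Weighting.Reach.nil (ha : 0 < a) (S : LabelledMaps a b c) : W.Reach ha [] S S :=
  ⟨fun _ => none, rfl, by simp⟩

theorem Weighting.Reach.cons {ha : 0 < a} {v : CPLSVar a b c} {L : List (CPLSVar a b c)}
    {S S₁ S' : LabelledMaps a b c} (o : Option Bool) (h1 : S = undo ha v o S₁)
    (h2 : W.weight S ≤ undoWeight ε o * W.weight S₁) (h : W.Reach ha L S₁ S') :
    W.Reach ha (v :: L) S S' := by
  obtain ⟨o', h3, h4⟩ := h
  refine ⟨fun k => Nat.casesOn k o o', by rw [h1, h3]; rfl, h2.trans ?_⟩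
  rw [List.length_cons, Finset.prod_range_succ', mul_comm (Finset.prod _ _), mul_assoc]
  exact mul_le_mul_right h4 _

theorem Weighting.Reach.append {ha : 0 < a} {L L' : List (CPLSVar a b c)}
    {S S₁ S' : LabelledMaps a b c} (h : W.Reach ha L S S₁) (h' : W.Reach ha L' S₁ S') :
    W.Reach ha (L ++ L') S S' := by
  obtain ⟨o, h1, h2⟩ := h
  obtain ⟨o', h3, h4⟩ := h'
  refine ⟨fun k => if k < L.length then o k else o' (k - L.length), ?_, h2.trans ?_⟩
  · rw [undoAll_append, h1, h3]
    simp only [not_lt.2 (Nat.le_add_left _ _), if_false, Nat.add_sub_cancel]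
    exact undoAll_congr ha (fun k hk => (if_pos hk).symm) _
  · rw [List.length_append, Finset.prod_range_add, mul_assoc]
    have e1 : ∏ k ∈ Finset.range L.length,
        undoWeight ε (if k < L.length then o k else o' (k - L.length)) =
        ∏ k ∈ Finset.range L.length, undoWeight ε (o k) :=
      Finset.prod_congr rfl fun k hk => by rw [if_pos (Finset.mem_range.1 hk)]
    simp only [e1, not_lt.2 (Nat.le_add_right _ _), if_false, Nat.add_sub_cancel_left]
    gcongr

/-! ### Extending labelled maps towards a legal restriction -/

/-- A legal restriction in terms of its functions and the states of the nodes. -/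
structure Target (σ : Restriction a b c) (F : PartialMaps a b) (τ : Node a b → PathState c) :
    Prop where
  injective : F.Injective
  eq_f : ∀ i x j, σ (.f i x j) = (F i x).map fun z => z.val.testBit j.val
  edge : ∀ ν μ, F.Edge ν μ → τ μ = τ ν
  eq_G : ∀ i x y, σ (.G i x y) = (τ (i, x)).colourValue y
  eq_u : ∀ (ha : 0 < a) x j, σ (.u x j) = (τ (⟨a - 1, Nat.sub_lt ha one_pos⟩, x)).bitValue j

/-- States become attributes of nodes that are constant along edges, which is convenient when paths
are cut and joined. Where the state `zero` may occur is not recorded, since it is not needed for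
building the extension. -/
theorem exists_target {σ : Restriction a b c} (h : σ.Legal) : ∃ F τ, Target σ F τ := by
  obtain ⟨F, hF, hf, hp⟩ := h
  choose t _ ht using hp
  let h (ν : Node a b) : F.Head := ⟨F.headOf ν, F.isHead_headOf ν⟩
  refine ⟨F, fun ν => t (h ν), hF, hf, fun ν μ he => ?_, fun i x y => ?_, fun ha x j => ?_⟩
  · have : h μ = h ν := Subtype.ext (hF.headOf_congr (.single he))
    simp only [this]
  · exact (ht (h (i, x)) (i, x) (F.headOf_path _)).1 y
  · exact (ht (h _) (_, x) (F.headOf_path _)).2 (Nat.sub_add_cancel ha) j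

open Classical in
/-- The least term of the disjunction that is true in `ρ`, in some fixed well-ordering. -/
noncomputable def firstTerm (ρ : Restriction a b c) (D : Set (List (CPLSVar a b c × Bool))) :
    List (CPLSVar a b c × Bool) :=
  if h : {t | t ∈ D ∧ ρ.SatTerm t}.Nonempty then
    (IsWellFounded.wf (r := WellOrderingRel)).min _ h
  else []

section Extension

variable {σ : Restriction a b c} {F : PartialMaps a b} {τ : Node a b → PathState c}

theorem Target.path (hT : Target σ F τ) {ν μ : Node a b}
    (h : Relation.ReflTransGen F.Edge ν μ) : τ μ = τ ν := by
  induction h with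
  | refl => rfl
  | tail _ h ih => rw [hT.edge _ _ h, ih]

theorem Target.headOf (hT : Target σ F τ) {F' : PartialMaps a b} (h : F'.Le F) (ν : Node a b) :
    τ (F'.headOf ν) = τ ν :=
  (hT.path (h.reflTransGen (F'.headOf_path ν))).symm

/-- All functions agree with those of the target, and all states are those of the target, with
the exception that some paths which have no colours in the target may be coloured by `z₀`. -/
def Compatible (F : PartialMaps a b) (τ : Node a b → PathState c) (z₀ : Option (Fin c))
    (S : LabelledMaps a b c) : Prop :=
  S.1.Le F ∧ ∀ ν, S.state ν = .uncoloured ∨ S.state ν = τ ν ∨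
    τ ν = .zero ∧ ∃ z ∈ z₀, S.state ν = .single z

/-- The states can be read off the variables `G_i(x, y)` because there is at least one colour, and
the values `f_i(x)` off their bits because there is at least one bit. -/
theorem Target.compatible (hT : Target σ F τ) (hb : 0 < Nat.log 2 b)
    (hbit : ∀ z z' : Fin b, (∀ j : Fin (Nat.log 2 b), z.val.testBit j = z'.val.testBit j) → z = z')
    (hc : 0 < c) {S : LabelledMaps a b c} (hS : S.1.Injective)
    (h : σ.Extends S.restriction) : Compatible F τ none S := by
  refine ⟨fun i x z hz => ?_, fun ν => ?_⟩
  · have key : ∀ j : Fin (Nat.log 2 b),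
        (F i x).map (fun z => z.val.testBit j.val) = some (z.val.testBit j.val) := by
      intro j
      rw [← hT.eq_f]
      exact h _ _ (by rw [restriction_f, hz]; rfl)
    cases hz' : F i x with
    | none => simpa [hz'] using key ⟨0, hb⟩
    | some z' => rw [hbit z' z fun j => by simpa [hz'] using key j]
  · obtain ⟨i, x⟩ := ν
    have key : ∀ y e, (S.state (i, x)).colourValue y = some e →
        (τ (i, x)).colourValue y = some e := by
      intro y e he
      rw [← hT.eq_G]
      exact h _ _ (by rw [restriction_G hS, he])
    cases hs : S.state (i, x) with
    | uncoloured => exact .inl rfl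
    | zero =>
      refine .inr (.inl ?_)
      rw [hs] at key
      cases ht : τ (i, x) with
      | uncoloured => simpa [ht, PathState.colourValue] using key ⟨0, hc⟩ false rfl
      | zero => rfl
      | single z => simpa [ht, PathState.colourValue] using key z false rfl
    | single z =>
      refine .inr (.inl ?_)
      rw [hs] at key
      have := key z true (by simp [PathState.colourValue])
      cases ht : τ (i, x) with
      | uncoloured => simp [ht, PathState.colourValue] at this
      | zero => simp [ht, PathState.colourValue] at this
      | single z' =>
        have : z = z' := by simpa [ht, PathState.colourValue] using this
        rw [this]

/-! ### Joining paths and colouring paths -/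

theorem headState_congr {κ κ' : Node a b → Option (Fin c)} {h h' : Node a b}
    (hh : ¬ (h.1.val = 0 ∧ h.2.val = 0)) (hh' : ¬ (h'.1.val = 0 ∧ h'.2.val = 0))
    (e : κ h = κ' h') : headState κ h = headState κ' h' := by
  rw [headState, headState, if_neg hh, if_neg hh', e]

theorem headState_congr_label {κ κ' : Node a b → Option (Fin c)} {h : Node a b}
    (e : κ h = κ' h) : headState κ h = headState κ' h := by
  rw [headState, headState, e]

/-- Few values of every function are undefined. -/
def Dense (K : ℕ) (F : PartialMaps a b) : Prop :=
  ∀ i, (Finset.univ.filter fun x => F i x = none).card ≤ K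

theorem Dense.of_le {F F' : PartialMaps a b} (hF : Dense K F) (h : F.Le F') : Dense K F' := by
  refine fun i => (Finset.card_le_card fun x hx => ?_).trans (hF i)
  simp only [Finset.mem_filter, Finset.mem_univ, true_and] at hx ⊢
  cases hz : F i x with
  | none => rfl
  | some z => rw [h i x z hz] at hx; simp at hx

/-- Defining `f_i(x) = z` joins the path through `src i x` to the one that begins at `tgt i z`, and
the first node of the former determines the new state. If the former is uncoloured, the two labels
are exchanged so that a colour of the latter stays visible. Otherwise its state is that of the
target, with which the latter can only agree. One bit tells which case occurred. -/
theorem exists_join (hT : Target σ F τ) (ha : 0 < a) {S : LabelledMaps a b c}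
    (hS : Compatible F τ none S) (hK : Dense K S.1) {i : Fin (a - 1)} {x z : Fin b}
    (hz : F i x = some z) (h : S.1 i x = none) (j : Fin (Nat.log 2 b)) :
    ∃ S' o, S = undo ha (.f i x j) o S' ∧ W.weight S ≤ undoWeight ε o * W.weight S' ∧
      Compatible F τ none S' ∧ S'.Refines S ∧ S'.1 i x = F i x := by
  have hle : (S.1.set i x (some z)).Le F := by
    intro i' x' z' hz'
    rw [set_apply] at hz'
    split_ifs at hz' with h1
    · rw [h1.1, h1.2, hz, hz']
    · exact hS.1 _ _ _ hz'
  have hinj : (S.1.set i x (some z)).Injective := hle.injective hT.injective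
  have hhead := headOf_set h hinj
  -- The first node of the path through `src i x` is the same after the join, so `undo` finds both
  -- labels to be exchanged.
  have hsrc : (S.1.set i x (some z)).headOf (src i x) = S.1.headOf (src i x) := by
    rw [hhead, if_neg (headOf_src_ne_tgt _ _ _ _)]
  have hw := W.maps_le S.1 i x z h hinj (hK i)
  have hτ : τ (tgt i z) = τ (S.1.headOf (src i x)) := by
    rw [hT.headOf hS.1]
    exact hT.edge _ _ (edge_iff.2 ⟨i, x, z, rfl, rfl, hz⟩)
  have hS2 : ∀ ν, S.state ν = .uncoloured ∨ S.state ν = τ ν := fun ν => by simpa using hS.2 ν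
  have htgt : S.1.headOf (tgt i z) = tgt i z :=
    (hS.1.injective hT.injective).headOf_eq (isHead_tgt_of_set h hinj) .refl
  have hroot : ¬ ((tgt i z : Node a b).1.val = 0 ∧ (tgt i z : Node a b).2.val = 0) := by
    simp [tgt]
  have hs2 := hS2 (tgt i z)
  rw [state, htgt] at hs2
  have hs1 := hS2 (src i x)
  rw [state, ← hT.headOf hS.1] at hs1
  set h₁ := S.1.headOf (src i x) with hh₁
  by_cases hu : headState S.2 h₁ = .uncoloured
  · let κ : Node a b → Option (Fin c) := fun ν => S.2 (Equiv.swap h₁ (tgt i z) ν)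
    -- Being uncoloured, `h₁` is not `(0,0)`; neither is `tgt i z`, which lies on a positive level.
    -- So both states are given by the labels.
    have hκ1 : headState κ h₁ = headState S.2 (tgt i z) :=
      headState_congr (headState_eq_uncoloured.1 hu).1 hroot (by simp [κ])
    have hκ : ∀ μ, μ ≠ h₁ → μ ≠ tgt i z → headState κ μ = headState S.2 μ := fun μ h1 h2 =>
      headState_congr_label (by simp only [κ]; rw [Equiv.swap_apply_of_ne_of_ne h1 h2])
    have hst : ∀ ν, state (S.1.set i x (some z), κ) ν = if S.1.headOf ν = tgt i z ∨ S.1.headOf ν = h₁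
        then headState S.2 (tgt i z) else S.state ν := by
      intro ν
      rw [state, hhead]
      by_cases h1 : S.1.headOf ν = tgt i z
      · rw [if_pos h1, if_pos (.inl h1), hκ1]
      · rw [if_neg h1]
        by_cases h2 : S.1.headOf ν = h₁
        · rw [if_pos (.inr h2), h2, hκ1]
        · rw [if_neg (by tauto), hκ _ h2 h1, state]
    refine ⟨(S.1.set i x (some z), κ), some true, ?_, ?_, ⟨hle, fun ν => ?_⟩,
      ⟨le_set h _, fun ν => ?_⟩, ?_⟩
    · refine Prod.ext (set_set_none h _).symm (funext fun ν => ?_)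
      change S.2 ν = (match S.1.set i x (some z) i x with
        | none => κ ν
        | some z' => κ (Equiv.swap ((S.1.set i x (some z)).headOf (src i x)) (tgt i z') ν))
      rw [set_self, hsrc]
      change S.2 ν = S.2 (Equiv.swap h₁ (tgt i z) (Equiv.swap h₁ (tgt i z) ν))
      rw [← Equiv.trans_apply, Equiv.swap_swap, Equiv.refl_apply]
    · have : ∏ ν, W.label (κ ν) = ∏ ν, W.label (S.2 ν) :=
        Equiv.prod_comp (Equiv.swap h₁ (tgt i z)) fun ν => W.label (S.2 ν)
      simp only [Weighting.weight, undoWeight, this, Option.isSome_some, if_true, ← mul_assoc]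
      exact mul_le_mul_left hw _
    · rw [hst]
      split_ifs with h1
      · have : τ ν = τ (tgt i z) := by
          rw [← hT.headOf hS.1 ν]
          rcases h1 with h1 | h1 <;> rw [h1]
          exact hτ.symm
        rw [this]
        tauto
      · exact hS.2 ν
    · rw [hst]
      split_ifs with h1
      · rcases h1 with h1 | h1
        · exact .inr (by rw [state, h1])
        · exact .inl (by rw [state, h1, hu])
      · exact .inr rfl
    · exact (set_self _ _ _ _).trans hz.symm
  · have hs1' := hs1.resolve_left hu
    have hst : ∀ ν, state (S.1.set i x (some z), S.2) ν = if S.1.headOf ν = tgt i z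
        then headState S.2 h₁ else S.state ν := by
      intro ν
      rw [state, hhead]
      split_ifs <;> rfl
    have hτν : ∀ ν, S.1.headOf ν = tgt i z → τ ν = τ h₁ := fun ν h1 => by
      rw [← hT.headOf hS.1 ν, h1, hτ]
    refine ⟨(S.1.set i x (some z), S.2), some false, ?_, ?_, ⟨hle, fun ν => ?_⟩,
      ⟨le_set h _, fun ν => ?_⟩, ?_⟩
    · exact Prod.ext (set_set_none h _).symm rfl
    · simp only [Weighting.weight, undoWeight, Option.isSome_some, if_true, ← mul_assoc]
      exact mul_le_mul_left hw _
    · rw [hst]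
      split_ifs with h1
      · exact .inr (.inl (by rw [hs1', hτν ν h1]))
      · exact hS.2 ν
    · rw [hst]
      split_ifs with h1
      · rcases hS2 ν with h2 | h2
        · exact .inl h2
        · exact .inr (by rw [hs1', h2, hτν ν h1])
      · exact .inr rfl
    · exact (set_self _ _ _ _).trans hz.symm

/-- A value that is already defined, for instance through another bit of the same `f_i(x)`, gets the
trivial instruction. Density persists since values are only added. -/
theorem exists_joins (hT : Target σ F τ) (ha : 0 < a) (L : List (CPLSVar a b c))
    {S : LabelledMaps a b c} (hS : Compatible F τ none S) (hK : Dense K S.1)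
    (hL : ∀ i x j, .f i x j ∈ L → F i x ≠ none) :
    ∃ S', W.Reach ha L S S' ∧ Compatible F τ none S' ∧ S'.Refines S ∧
      ∀ i x j, .f i x j ∈ L → S'.1 i x = F i x := by
  induction L generalizing S with
  | nil => exact ⟨S, .nil ha S, hS, .refl S, by simp⟩
  | cons v L ih =>
    have step : ∃ S₁ o, S = undo ha v o S₁ ∧ W.weight S ≤ undoWeight ε o * W.weight S₁ ∧
        Compatible F τ none S₁ ∧ S₁.Refines S ∧ ∀ i x j, .f i x j = v → S₁.1 i x = F i x := by
      have stay : (∀ i x j, .f i x j = v → S.1 i x = F i x) →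
          ∃ S₁ o, S = undo ha v o S₁ ∧ W.weight S ≤ undoWeight ε o * W.weight S₁ ∧
            Compatible F τ none S₁ ∧ S₁.Refines S ∧ ∀ i x j, .f i x j = v → S₁.1 i x = F i x :=
        fun h => ⟨S, none, (undo_none ha v S).symm, by simp [undoWeight], hS, .refl S, h⟩
      cases v with
      | G i x y => exact stay (by simp)
      | u x j => exact stay (by simp)
      | f i x j =>
        cases h : S.1 i x with
        | some z =>
          refine stay ?_
          rintro i' x' j' ⟨⟩
          rw [h, hS.1 _ _ _ h]
        | none =>
          obtain ⟨z, hz⟩ := Option.ne_none_iff_exists'.1 (hL i x j List.mem_cons_self)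
          obtain ⟨S₁, o, h1, h2, h3, h4, h5⟩ := exists_join (W := W) hT ha hS hK hz h j
          refine ⟨S₁, o, h1, h2, h3, h4, ?_⟩
          rintro i' x' j' ⟨⟩
          exact h5
    obtain ⟨S₁, o, h1, h2, h3, h4, h5⟩ := step
    obtain ⟨S', h6, h7, h8, h9⟩ := ih h3 (hK.of_le h4.1) fun i x j hj =>
      hL i x j (List.mem_cons_of_mem _ hj)
    refine ⟨S', h6.cons o h1 h2, h7, h8.trans h4, fun i x j hj => ?_⟩
    rcases List.mem_cons.1 hj with hj | hj
    · have := h5 i x j hj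
      obtain ⟨z, hz⟩ := Option.ne_none_iff_exists'.1 (hL i x j (hj ▸ List.mem_cons_self))
      rw [hz] at this ⊢
      exact h8.1 _ _ _ this
    · exact h9 i x j hj

/-- The path takes the colour of the target if there is one. If the target has no colours there, the
path is a detached piece, as its first node is not `(0,0)`; a piece of this kind can only get a
single colour, and `z₀` is used. -/
theorem exists_colouring (hT : Target σ F τ) (ha : 0 < a) (z₀ : Fin c) {S : LabelledMaps a b c}
    (hS : Compatible F τ (some z₀) S) {v : CPLSVar a b c} (hv : ∀ i x j, v ≠ .f i x j)
    (hτ : τ (site ha v) ≠ .uncoloured) (h : S.state (site ha v) = .uncoloured) :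
    ∃ S' o, S = undo ha v o S' ∧ W.weight S ≤ undoWeight ε o * W.weight S' ∧
      Compatible F τ (some z₀) S' ∧ S'.Refines S ∧ S'.state (site ha v) ≠ .uncoloured := by
  classical
  have hinj := hS.1.injective hT.injective
  set h₀ := S.1.headOf (site ha v) with hh₀
  obtain ⟨hroot, hnone⟩ := headState_eq_uncoloured.1 h
  obtain ⟨z, hz⟩ : ∃ z, τ h₀ = .single z ∨ τ h₀ = .zero ∧ z = z₀ := by
    rw [← hT.headOf hS.1] at hτ
    cases ht : τ h₀ with
    | uncoloured => exact absurd ht hτ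
    | zero => exact ⟨z₀, .inr ⟨rfl, rfl⟩⟩
    | single z => exact ⟨z, .inl rfl⟩
  let κ : Node a b → Option (Fin c) := Function.update S.2 h₀ (some z)
  have hst : ∀ ν, state (S.1, κ) ν = if S.1.headOf ν = h₀ then .single z else S.state ν := by
    intro ν
    simp only [state]
    split_ifs with h1
    · rw [h1, headState, if_neg hroot]
      simp [κ]
    · exact headState_congr_label (by simp [κ, h1])
  refine ⟨(S.1, κ), some true, ?_, ?_, ⟨hS.1, fun ν => ?_⟩, ⟨fun _ _ _ h => h, fun ν => ?_⟩, ?_⟩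
  · have : (S.1, Function.update κ h₀ none) = S := by
      refine Prod.ext rfl ?_
      simp only [κ, Function.update_idem]
      rw [← hnone, Function.update_eq_self]
    cases v with
    | f i x j => exact absurd rfl (hv i x j)
    | G i x y => exact this.symm
    | u x j => exact this.symm
  · simp only [Weighting.weight, undoWeight, Option.isSome_some, if_true]
    rw [← Finset.mul_prod_erase Finset.univ _ (Finset.mem_univ h₀),
      ← Finset.mul_prod_erase Finset.univ (fun ν => W.label (κ ν)) (Finset.mem_univ h₀), hnone]
    have h1 : ∏ ν ∈ Finset.univ.erase h₀, W.label (κ ν) =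
        ∏ ν ∈ Finset.univ.erase h₀, W.label (S.2 ν) :=
      Finset.prod_congr rfl fun ν hν => by simp [κ, (Finset.mem_erase.1 hν).1]
    have h2 : κ h₀ = some z := by simp [κ]
    rw [h1, h2]
    calc W.maps S.1 * (W.label none * ∏ ν ∈ Finset.univ.erase h₀, W.label (S.2 ν))
        ≤ W.maps S.1 * (ε * W.label (some z) * ∏ ν ∈ Finset.univ.erase h₀, W.label (S.2 ν)) := by
          gcongr
          exact W.label_le z
      _ = _ := by ring
  · rw [hst]
    split_ifs with h1
    · rw [← hT.headOf hS.1 ν, h1]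
      rcases hz with hz | ⟨hz, rfl⟩
      · exact .inr (.inl hz.symm)
      · exact .inr (.inr ⟨hz, _, rfl, rfl⟩)
    · exact hS.2 ν
  · rw [hst]
    split_ifs with h1
    · exact .inl (by rw [state, h1]; exact h)
    · exact .inr rfl
  · rw [hst, if_pos rfl]
    simp

theorem exists_colourings (hT : Target σ F τ) (ha : 0 < a) (z₀ : Fin c)
    (L : List (CPLSVar a b c)) {S : LabelledMaps a b c} (hS : Compatible F τ (some z₀) S)
    (hL : ∀ v ∈ L, (∀ i x j, v ≠ .f i x j) → τ (site ha v) ≠ .uncoloured) :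
    ∃ S', W.Reach ha L S S' ∧ Compatible F τ (some z₀) S' ∧ S'.Refines S ∧
      ∀ v ∈ L, (∀ i x j, v ≠ .f i x j) → S'.state (site ha v) ≠ .uncoloured := by
  induction L generalizing S with
  | nil => exact ⟨S, .nil ha S, hS, .refl S, by simp⟩
  | cons v L ih =>
    have step : ∃ S₁ o, S = undo ha v o S₁ ∧ W.weight S ≤ undoWeight ε o * W.weight S₁ ∧
        Compatible F τ (some z₀) S₁ ∧ S₁.Refines S ∧
        ((∀ i x j, v ≠ .f i x j) → S₁.state (site ha v) ≠ .uncoloured) := by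
      by_cases h : (∀ i x j, v ≠ .f i x j) ∧ S.state (site ha v) = .uncoloured
      · obtain ⟨S₁, o, h1, h2, h3, h4, h5⟩ :=
          exists_colouring (W := W) hT ha z₀ hS h.1 (hL v List.mem_cons_self h.1) h.2
        exact ⟨S₁, o, h1, h2, h3, h4, fun _ => h5⟩
      · exact ⟨S, none, (undo_none ha v S).symm, by simp [undoWeight], hS, .refl S,
          fun h1 h2 => h ⟨h1, h2⟩⟩
    obtain ⟨S₁, o, h1, h2, h3, h4, h5⟩ := step
    obtain ⟨S', h6, h7, h8, h9⟩ := ih h3 fun v hv => hL v (List.mem_cons_of_mem _ hv)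
    refine ⟨S', h6.cons o h1 h2, h7, h8.trans h4, fun v' hv' hf => ?_⟩
    rcases List.mem_cons.1 hv' with rfl | hv'
    · rcases h8.2 (site ha v') with h10 | h10
      · exact absurd h10 (h5 hf)
      · rw [h10]
        exact h5 hf
    · exact h9 v' hv' hf

/-- Labelled maps that do not decide a disjunction can be extended so that they satisfy it, and the
extension can be undone at the variables of the first term that is then true. -/
theorem exists_reach (ha : 0 < a) (hb : 0 < Nat.log 2 b)
    (hbit : ∀ z z' : Fin b, (∀ j : Fin (Nat.log 2 b), z.val.testBit j = z'.val.testBit j) → z = z')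
    {D : Set (List (CPLSVar a b c × Bool))} (hD : ∀ t ∈ D, t.length < c)
    {S : LabelledMaps a b c} (hS : S.1.Injective) (hK : Dense K S.1)
    (h : ¬ S.restriction.Decides D) :
    ∃ S', S'.1.Injective ∧ S'.Refines S ∧ S'.restriction.Sat D ∧
      W.Reach ha (firstTerm S'.restriction D ++ firstTerm S'.restriction D |>.map Prod.fst)
        S S' := by
  classical
  obtain ⟨-, h⟩ := not_or.1 h
  push Not at h
  obtain ⟨σ₀, hσ₀, hσ₀S, t₀, ht₀, ht₀'⟩ := h
  set A : Set (List (CPLSVar a b c × Bool)) :=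
    {t | t ∈ D ∧ ∃ σ : Restriction a b c, σ.Legal ∧ σ.Extends S.restriction ∧ σ.SatTerm t} with hA
  have hne : A.Nonempty := ⟨t₀, ht₀, σ₀, hσ₀, hσ₀S, ht₀'⟩
  -- The minimum is over terms true in any legal extension of `S`, not just in one chosen extension.
  -- This is what makes `t` the least term true in the final `S'`.
  set t := (IsWellFounded.wf (r := WellOrderingRel)).min A hne with ht
  obtain ⟨htD, σ, hσ, hσS, hσt⟩ : t ∈ A := WellFounded.min_mem _ _ _
  obtain ⟨F, τ, hT⟩ := exists_target hσ
  have hc : 0 < c := lt_of_le_of_lt (Nat.zero_le _) (hD t htD)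
  have hcomp := hT.compatible hb hbit hc hS hσS
  -- All joins precede all colourings: a piece coloured `z₀` against the zero state of the target
  -- could not be joined consistently. This is why the variables of `t` are listed twice.
  obtain ⟨S₁, h1, h2, h3, h4⟩ := exists_joins (W := W) hT ha (t.map Prod.fst) hcomp hK (by
    intro i x j hj
    obtain ⟨⟨v, e⟩, he, rfl⟩ := List.mem_map.1 hj
    have := hσt _ he
    intro h0
    rw [hT.eq_f, h0] at this
    simp at this)
  -- A term with fewer than `c` literals leaves some colour unmentioned.
  obtain ⟨z₀, hz₀⟩ : ∃ z₀ : Fin c, ∀ i x e, (CPLSVar.G i x z₀, e) ∉ t := by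
    let f : CPLSVar a b c × Bool → Option (Fin c) := fun e => match e.1 with
      | .G _ _ y => some y
      | _ => none
    have hcard : (t.filterMap f).toFinset.card < Fintype.card (Fin c) := by
      rw [Fintype.card_fin]
      exact ((List.toFinset_card_le _).trans (List.length_filterMap_le _ _)).trans_lt (hD t htD)
    obtain ⟨z₀, hz₀⟩ := Finset.exists_mem_notMem_of_card_lt_card
      (hcard.trans_eq Finset.card_univ.symm)
    refine ⟨z₀, fun i x e he => hz₀.2 (List.mem_toFinset.2 (List.mem_filterMap.2 ⟨_, he, rfl⟩))⟩
  obtain ⟨S', h5, h6, h7, h8⟩ := exists_colourings (W := W) hT ha z₀ (t.map Prod.fst)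
    (S := S₁) ⟨h2.1, fun ν => (h2.2 ν).imp_right (Or.imp_right (by simp))⟩ (by
    intro v hv hf h0
    obtain ⟨⟨v, e⟩, he, rfl⟩ := List.mem_map.1 hv
    have := hσt _ he
    cases v with
    | f i x j => exact hf i x j rfl
    | G i x y =>
      rw [hT.eq_G] at this
      simp only [site] at h0
      simp [h0, PathState.colourValue] at this
    | u x j =>
      rw [hT.eq_u ha] at this
      simp only [site] at h0
      simp [h0, PathState.bitValue] at this)
  have hinj : S'.1.Injective := h6.1.injective hT.injective
  have hsat : S'.restriction.SatTerm t := by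
    rintro ⟨v, e⟩ he
    have hv := hσt _ he
    have hmem : v ∈ t.map Prod.fst := List.mem_map.2 ⟨_, he, rfl⟩
    cases v with
    | f i x j =>
      have h9 := h4 i x j hmem
      simp only [hT.eq_f] at hv
      simp only [restriction_f]
      cases hz : F i x with
      | none => simp [hz] at hv
      | some z => rw [h7.1 i x z (h9.trans hz), ← hz, hv]
    | G i x y =>
      have h9 := h8 _ hmem (by simp)
      have h10 := h6.2 (i, x)
      simp only [site] at h9
      simp only [hT.eq_G] at hv
      simp only [restriction_G hinj]
      rcases h10 with h10 | h10 | ⟨h10, z, hz, h11⟩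
      · exact absurd h10 h9
      · rw [h10, hv]
      · obtain rfl : z₀ = z := by simpa using hz
        rw [h10] at hv
        rw [h11, ← hv]
        -- On a piece coloured `z₀`, all `G_i(x, y)` with `y ≠ z₀` are `0`, as they are on the zero
        -- path of the target.
        have : y ≠ z₀ := by
          rintro rfl
          exact hz₀ i x e he
        simp [PathState.colourValue, this]
    | u x j =>
      have h9 := h8 _ hmem (by simp)
      have h10 := h6.2 (site ha (.u x j : CPLSVar a b c))
      simp only [site] at h9 h10
      simp only [hT.eq_u ha] at hv
      simp only [restriction_u hinj ha]
      rcases h10 with h10 | h10 | ⟨h10, -⟩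
      · exact absurd h10 h9
      · rw [h10, hv]
      -- On the zero path of the target `u(x)` is undefined, so `t` cannot contain this literal.
      · simp [h10, PathState.bitValue] at hv
  have hfirst : firstTerm S'.restriction D = t := by
    have hB : {t | t ∈ D ∧ S'.restriction.SatTerm t}.Nonempty := ⟨t, htD, hsat⟩
    rw [firstTerm, dif_pos hB]
    set t' := (IsWellFounded.wf (r := WellOrderingRel)).min _ hB with ht'
    have hmem : t' ∈ {t | t ∈ D ∧ S'.restriction.SatTerm t} := WellFounded.min_mem _ _ _
    have n1 : ¬ WellOrderingRel t t' := WellFounded.not_lt_min _ _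
      (show t ∈ {t | t ∈ D ∧ S'.restriction.SatTerm t} from ⟨htD, hsat⟩)
    -- A term true in `S'` is true in a legal extension of `S`, hence it competes in the minimum
    -- that defines `t`.
    have n2 : ¬ WellOrderingRel t' t := WellFounded.not_lt_min _ _ (show t' ∈ A from
      ⟨hmem.1, _, legal_restriction hinj, (h7.trans h3).extends hinj, hmem.2⟩)
    rcases trichotomous_of WellOrderingRel t' t with h | h | h
    · exact absurd h n2
    · exact h
    · exact absurd h n1
  refine ⟨S', hinj, h7.trans h3, ⟨t, htD, hsat⟩, ?_⟩
  rw [hfirst, List.map_append]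
  exact h1.append h5

end Extension

end LabelledMaps

namespace LabelledMaps

open PartialMaps

variable {a b c : ℕ}

theorem firstTerm_mem {ρ : Restriction a b c} {D : Set (List (CPLSVar a b c × Bool))}
    (h : ρ.Sat D) : firstTerm ρ D ∈ D := by
  have h' : {t | t ∈ D ∧ ρ.SatTerm t}.Nonempty := h
  rw [firstTerm, dif_pos h']
  exact (WellFounded.min_mem _ _ h').1

/-! ### The weight of the labelled maps that do not decide a decision tree -/

/-- Extend a finite sequence of instructions by trivial ones. -/
def padUndo {R : ℕ} (o : Fin R → Option Bool) (k : ℕ) : Option Bool :=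
  if h : k < R then o ⟨k, h⟩ else none

theorem sum_prod_undoWeight (ε : ℝ≥0∞) (R : ℕ) :
    ∑ o : Fin R → Option Bool, ∏ k, undoWeight ε (o k) = (1 + 2 * ε) ^ R := by
  have h := Finset.prod_univ_sum (fun _ : Fin R => (Finset.univ : Finset (Option Bool)))
    fun _ o => undoWeight ε o
  rw [Fintype.piFinset_univ] at h
  rw [← h]
  simp [undoWeight, Fintype.sum_option, two_mul]

theorem sum_prod_undoWeight_ne (ε : ℝ≥0∞) (R : ℕ) :
    ∑ o ∈ Finset.univ.erase (fun _ : Fin R => (none : Option Bool)), ∏ k, undoWeight ε (o k) =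
      (1 + 2 * ε) ^ R - 1 := by
  have h := Finset.add_sum_erase Finset.univ
    (fun o : Fin R → Option Bool => ∏ k, undoWeight ε (o k)) (Finset.mem_univ fun _ => none)
  rw [sum_prod_undoWeight] at h
  rw [← h]
  simp [undoWeight]

variable {K : ℕ} {ε : ℝ≥0∞} {W : Weighting a b c K ε}

/-- Padding by trivial instructions, which have weight one, gives all codes a common finite index
set. -/
theorem Weighting.Reach.exists_fin {ha : 0 < a} {L : List (CPLSVar a b c)}
    {S S' : LabelledMaps a b c} (h : W.Reach ha L S S') {R : ℕ} (hR : L.length ≤ R) :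
    ∃ o : Fin R → Option Bool, S = undoAll ha L (padUndo o) S' ∧
      W.weight S ≤ (∏ k, undoWeight ε (o k)) * W.weight S' := by
  obtain ⟨o, h1, h2⟩ := h
  refine ⟨fun k => if k < L.length then o k else none, ?_, ?_⟩
  · rw [h1]
    refine undoAll_congr ha (fun k hk => ?_) S'
    simp [padUndo, hk, hk.trans_le hR]
  · obtain ⟨d, rfl⟩ := Nat.exists_eq_add_of_le hR
    rw [← Finset.prod_range fun k => undoWeight ε (if k < L.length then o k else none),
      Finset.prod_range_add]
    have e1 : ∏ k ∈ Finset.range L.length, undoWeight ε (if k < L.length then o k else none) =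
        ∏ k ∈ Finset.range L.length, undoWeight ε (o k) :=
      Finset.prod_congr rfl fun k hk => by rw [if_pos (Finset.mem_range.1 hk)]
    have e2 : ∏ k ∈ Finset.range d, undoWeight ε
        (if L.length + k < L.length then o (L.length + k) else none) = 1 := by
      simp [undoWeight]
    rwa [e1, e2, mul_one]

open Classical in
/-- The truth values of disjunctions in `ρ`. -/
noncomputable def answers {Q : Type} (dnf : Q → Set (List (CPLSVar a b c × Bool)))
    (ρ : Restriction a b c) (q : Q) : Bool := decide (ρ.Sat (dnf q))

theorem answers_eq_true {Q : Type} {dnf : Q → Set (List (CPLSVar a b c × Bool))}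
    {ρ : Restriction a b c} {q : Q} : answers dnf ρ q = true ↔ ρ.Sat (dnf q) := by
  simp [answers]

/-- The variables of the term that makes the `j`-th query true, each of them twice. -/
noncomputable def queryVars {Q O : Type} (dnf : Q → Set (List (CPLSVar a b c × Bool)))
    (t : DecisionTree Q O) (j : ℕ) (ρ : Restriction a b c) : List (CPLSVar a b c) :=
  match t.query (answers dnf ρ) j with
  | none => []
  | some q => (firstTerm ρ (dnf q) ++ firstTerm ρ (dnf q)).map Prod.fst

/-- The list of variables depends on `S'` and `j` only, so the triple `(j, o, S')` determines `S`.
-/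
theorem exists_encoding {Q O : Type} {dnf : Q → Set (List (CPLSVar a b c × Bool))}
    {t : DecisionTree Q O} {r : ℕ} (hr : r < c) (ht : t.Forall fun q => ∀ u ∈ dnf q, u.length ≤ r)
    (ha : 0 < a) (hb : 0 < Nat.log 2 b)
    (hbit : ∀ z z' : Fin b, (∀ j : Fin (Nat.log 2 b), z.val.testBit j = z'.val.testBit j) → z = z')
    {S : LabelledMaps a b c} (hS : S.1.Injective) (hK : Dense K S.1)
    (h : ¬ t.AllOn (fun q => S.restriction.Decides (dnf q)) (answers dnf S.restriction)) :
    ∃ e : ℕ × (Fin (2 * r) → Option Bool) × LabelledMaps a b c,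
      (e.1 < t.depth ∧ e.2.1 ≠ fun _ => none) ∧
      S = undoAll ha (queryVars dnf t e.1 e.2.2.restriction) (padUndo e.2.1) e.2.2 ∧
      W.weight S ≤ (∏ k, undoWeight ε (e.2.1 k)) * W.weight e.2.2 := by
  obtain ⟨j, hj, q, hq, hfail, hbefore⟩ := DecisionTree.exists_first_failure h
  have hlen := ht.query hq
  obtain ⟨S', hS', href, hsat, hreach⟩ := exists_reach (W := W) ha hb hbit
    (fun u hu => (hlen u hu).trans_lt hr) hS hK hfail
  have hext := href.extends hS'
  have hq' : t.query (answers dnf S'.restriction) j = some q := by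
    rw [← hq]
    -- Earlier queries are decided by `S`: a true term stays true in `S'`, and a refuted query stays
    -- refuted because `S'` is a legal extension.
    refine DecisionTree.query_congr fun i hi q' hq' => ?_
    rw [Bool.eq_iff_iff, answers_eq_true, answers_eq_true]
    constructor
    · intro h1
      rcases hbefore i hi q' hq' with h2 | h2
      · exact h2
      · exact absurd h1 (h2 _ (legal_restriction hS') hext)
    · rintro ⟨u, hu, hu'⟩
      exact ⟨u, hu, hext.satTerm hu'⟩
  have hvars : queryVars dnf t j S'.restriction =
      (firstTerm S'.restriction (dnf q) ++ firstTerm S'.restriction (dnf q)).map Prod.fst := by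
    simp only [queryVars, hq']
  rw [← hvars] at hreach
  obtain ⟨o, h1, h2⟩ := hreach.exists_fin (R := 2 * r) (by
    have := hlen _ (firstTerm_mem hsat)
    rw [hvars]
    simp
    omega)
  refine ⟨(j, o, S'), ⟨hj, ?_⟩, h1, h2⟩
  -- With trivial instructions only, `S = S'` would satisfy the query that it does not decide.
  -- Excluding this code yields the term `- 1` in the bound.
  rintro rfl
  have hpad : padUndo (fun _ : Fin (2 * r) => (none : Option Bool)) = fun _ => none := by
    funext k
    simp [padUndo]
  simp only [hpad, undoAll_none] at h1
  rw [h1] at hfail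
  exact hfail (.inl hsat)

open Classical in
-- A union bound over codes. Each position contributes `1 + ε + ε`, for the trivial instruction and
-- the two proper ones, and for fixed `j` and `o` the weights of all possible `S'` add up to at most
-- one.
theorem sum_weight_not_allOn_le {Q O : Type} {dnf : Q → Set (List (CPLSVar a b c × Bool))}
    {t : DecisionTree Q O} {r : ℕ} (hr : r < c) (ht : t.Forall fun q => ∀ u ∈ dnf q, u.length ≤ r)
    (ha : 0 < a) (hb : 0 < Nat.log 2 b)
    (hbit : ∀ z z' : Fin b, (∀ j : Fin (Nat.log 2 b), z.val.testBit j = z'.val.testBit j) → z = z')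
    (hW : ∑ S, W.weight S ≤ 1) :
    ∑ S ∈ Finset.univ.filter (fun S : LabelledMaps a b c => S.1.Injective ∧ Dense K S.1 ∧
        ¬ t.AllOn (fun q => S.restriction.Decides (dnf q)) (answers dnf S.restriction)),
      W.weight S ≤ t.depth * ((1 + 2 * ε) ^ (2 * r) - 1) := by
  set B := Finset.univ.filter (fun S : LabelledMaps a b c => S.1.Injective ∧ Dense K S.1 ∧
        ¬ t.AllOn (fun q => S.restriction.Decides (dnf q)) (answers dnf S.restriction)) with hB
  have key : ∀ S ∈ B, ∃ e : ℕ × (Fin (2 * r) → Option Bool) × LabelledMaps a b c,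
      (e.1 < t.depth ∧ e.2.1 ≠ fun _ => none) ∧
      S = undoAll ha (queryVars dnf t e.1 e.2.2.restriction) (padUndo e.2.1) e.2.2 ∧
      W.weight S ≤ (∏ k, undoWeight ε (e.2.1 k)) * W.weight e.2.2 := by
    intro S hS
    obtain ⟨-, h1, h2, h3⟩ := Finset.mem_filter.1 hS
    exact exists_encoding hr ht ha hb hbit h1 h2 h3
  choose! e he1 he2 he3 using key
  have hinj : Set.InjOn e B := by
    intro S hS S' hS' h
    rw [he2 S hS, he2 S' hS', h]
  calc ∑ S ∈ B, W.weight S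
      ≤ ∑ S ∈ B, (∏ k, undoWeight ε ((e S).2.1 k)) * W.weight (e S).2.2 :=
        Finset.sum_le_sum he3
    _ = ∑ x ∈ B.image e, (∏ k, undoWeight ε (x.2.1 k)) * W.weight x.2.2 := by
        rw [Finset.sum_image hinj]
    _ ≤ ∑ x ∈ Finset.range t.depth ×ˢ (Finset.univ.erase fun _ => none) ×ˢ Finset.univ,
          (∏ k, undoWeight ε (x.2.1 k)) * W.weight x.2.2 := by
        refine Finset.sum_le_sum_of_subset fun x hx => ?_
        obtain ⟨S, hS, rfl⟩ := Finset.mem_image.1 hx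
        have := he1 S hS
        simp [this.1, this.2]
    _ = t.depth * (((1 + 2 * ε) ^ (2 * r) - 1) * ∑ S, W.weight S) := by
        rw [Finset.sum_product]
        simp only [Finset.sum_const, Finset.card_range, nsmul_eq_mul]
        rw [Finset.sum_product, ← sum_prod_undoWeight_ne, Finset.sum_mul_sum]
    _ ≤ t.depth * (((1 + 2 * ε) ^ (2 * r) - 1) * 1) := by gcongr
    _ = _ := by rw [mul_one]

end LabelledMaps

/-! ### Independent random variables -/

theorem PMF.independent_apply {ι : Type} [Fintype ι] [DecidableEq ι] {α : ι → Type}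
    [∀ i, Fintype (α i)] (μ : ∀ i, PMF (α i)) (g : ∀ i, α i) :
    PMF.independent μ g = ∏ i, μ i (g i) := rfl

theorem PMF.sum_univ {α : Type} [Fintype α] (μ : PMF α) : ∑ x, μ x = 1 := by
  rw [← tsum_fintype (L := .unconditional _)]
  exact μ.tsum_coe

/-- A subfamily of a family of independent random variables is independent. -/
theorem PMF.independent_map_comp {ι ι' α : Type} [Fintype ι] [DecidableEq ι] [Fintype ι']
    [DecidableEq ι'] [Fintype α] (μ : PMF α) (f : ι' ↪ ι) :
    (PMF.independent fun _ : ι => μ).map (fun κ h => κ (f h)) =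
      PMF.independent fun _ : ι' => μ := by
  classical
  ext g
  rw [PMF.map_apply, tsum_fintype, PMF.independent_apply]
  let t : ι → Finset α := fun i => Finset.univ.filter fun x => ∀ h, f h = i → x = g h
  -- The condition on `κ` restricts each coordinate separately, so the sum factors; coordinates
  -- outside the range of `f` contribute one.
  have ht : Finset.univ.filter (fun κ : ι → α => g = fun h => κ (f h)) = Fintype.piFinset t := by
    ext κ
    simp only [Finset.mem_filter, Finset.mem_univ, true_and, Fintype.mem_piFinset, t]
    constructor
    · rintro rfl i h rfl
      rfl
    · intro h
      exact funext fun x => (h (f x) x rfl).symm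
  trans ∑ κ ∈ Finset.univ.filter (fun κ : ι → α => g = fun h => κ (f h)), ∏ i, μ (κ i)
  · rw [Finset.sum_filter]
    refine Finset.sum_congr rfl fun κ _ => ?_
    split_ifs <;> rfl
  rw [ht, ← Finset.prod_univ_sum t fun _ x => μ x]
  have h1 : ∀ h, ∑ x ∈ t (f h), μ x = μ (g h) := by
    intro h
    have : t (f h) = {g h} := by
      ext x
      simp [t]
    rw [this, Finset.sum_singleton]
  have h2 : ∀ i ∉ Finset.univ.map f, ∑ x ∈ t i, μ x = 1 := by
    intro i hi
    have : t i = Finset.univ := by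
      ext x
      simp only [Finset.mem_filter, Finset.mem_univ, true_and, t, iff_true]
      rintro h rfl
      exact absurd (Finset.mem_map_of_mem f (Finset.mem_univ h)) hi
    rw [this, PMF.sum_univ]
  rw [← Finset.prod_subset (Finset.subset_univ (Finset.univ.map f)) fun i _ hi => h2 i hi,
    Finset.prod_map]
  exact Finset.prod_congr rfl fun h _ => h1 h

theorem PMF.coin_apply (p : unitInterval) (e : Bool) :
    PMF.coin p e = ENNReal.ofReal (if e then (p : ℝ) else 1 - p) := rfl

namespace RandomRestriction

open PartialMaps

variable {a b : ℕ}

theorem label_none (c : ℕ) [NeZero c] (q : unitInterval) :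
    label c q none = ENNReal.ofReal q := by
  simp [label, PMF.bind_apply, PMF.coin_apply, PMF.map_apply, tsum_fintype]

theorem label_some (c : ℕ) [NeZero c] (q : unitInterval) (z : Fin c) :
    label c q (some z) = ENNReal.ofReal (1 - q) * (c : ℝ≥0∞)⁻¹ := by
  simp [label, PMF.bind_apply, PMF.coin_apply, PMF.map_apply, tsum_fintype]

/-! ### The distribution of the partial maps -/

/-- The indicator function of the complement of the domains. -/
def undefinedAt (F : PartialMaps a b) (ν : Fin (a - 1) × Fin b) : Bool := (F ν.1 ν.2).isNone

theorem undefinedAt_toMaps (Z : Fin (a - 1) × Fin b → Bool) (e : ∀ i, Dom Z i ↪ Fin b) :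
    undefinedAt (toMaps Z e) = Z := by
  funext ν
  unfold undefinedAt toMaps
  split_ifs with h
  · simpa using h.symm
  · simpa using h

theorem toMaps_injective (Z : Fin (a - 1) × Fin b → Bool) (e : ∀ i, Dom Z i ↪ Fin b) :
    (toMaps Z e).Injective := by
  intro i x x' z h h'
  unfold toMaps at h h'
  split_ifs at h h' with h1 h2
  have := (e i).injective ((Option.some.inj h).trans (Option.some.inj h').symm)
  exact congrArg Subtype.val this

theorem toMaps_left_injective (Z : Fin (a - 1) × Fin b → Bool) :
    Function.Injective (toMaps Z) := by
  intro e e' h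
  funext i
  ext x
  have := congrFun (congrFun h i) x.1
  simp only [toMaps, dif_pos x.2] at this
  exact congrArg Fin.val (Option.some.inj this)

theorem exists_toMaps_eq {F : PartialMaps a b} (hF : F.Injective) :
    ∃ e, toMaps (undefinedAt F) e = F := by
  have h : ∀ i (x : Dom (undefinedAt F) i), ∃ z, F i x.1 = some z := fun i x =>
    Option.isSome_iff_exists.1 (by simpa [undefinedAt] using x.2)
  choose e he using h
  refine ⟨fun i => ⟨e i, fun x x' hx => Subtype.ext ?_⟩, ?_⟩
  · exact hF i x.1 x'.1 (e i x) (he i x) (by rw [hx]; exact he i x')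
  · funext i x
    unfold toMaps
    split_ifs with hx
    · exact (he i ⟨x, hx⟩).symm
    · have : (F i x).isNone = true := by simpa [undefinedAt] using hx
      exact (Option.isNone_iff_eq_none.1 this).symm

theorem maps_eq_zero {F : PartialMaps a b} (hF : ¬ F.Injective) (p : unitInterval) :
    maps a b p F = 0 := by
  rw [PMF.apply_eq_zero_iff]
  intro h
  obtain ⟨Z, -, hZ⟩ := (PMF.mem_support_bind_iff _ _ _).1 h
  obtain ⟨e, -, rfl⟩ := (PMF.mem_support_map_iff _ _ _).1 hZ
  exact hF (toMaps_injective Z e)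

theorem maps_map_undefinedAt (p : unitInterval) :
    (maps a b p).map undefinedAt = PMF.independent fun _ => PMF.coin p := by
  rw [maps, PMF.map_bind]
  have : ∀ Z : Fin (a - 1) × Fin b → Bool, PMF.map undefinedAt
      ((PMF.independent fun i => PMF.uniformOfFintype (Dom Z i ↪ Fin b)).map (toMaps Z)) =
      PMF.pure Z := by
    intro Z
    rw [PMF.map_comp]
    have : undefinedAt ∘ toMaps Z = Function.const _ Z := funext fun e => undefinedAt_toMaps Z e
    rw [this, PMF.map_const]
  simp only [this, PMF.bind_pure]

/-- The number of elements of the domain of `f_i`. -/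
def domCard (F : PartialMaps a b) (i : Fin (a - 1)) : ℕ :=
  (Finset.univ.filter fun x => F i x ≠ none).card

theorem maps_apply {F : PartialMaps a b} (hF : F.Injective) (p : unitInterval) :
    maps a b p F = (∏ ν, PMF.coin p (undefinedAt F ν)) *
      ∏ i, ((b.descFactorial (domCard F i) : ℕ) : ℝ≥0∞)⁻¹ := by
  obtain ⟨e, he⟩ := exists_toMaps_eq hF
  rw [maps, PMF.bind_apply, tsum_eq_single (undefinedAt F), PMF.independent_apply, PMF.map_apply,
    tsum_eq_single e, if_pos he.symm, PMF.independent_apply]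
  · congr 1
    refine Finset.prod_congr rfl fun i _ => ?_
    rw [PMF.uniformOfFintype_apply, Fintype.card_embedding_eq, Fintype.card_fin,
      Fintype.card_subtype, domCard]
    congr 4
    ext x
    simp [undefinedAt, Option.isSome_iff_ne_none]
  · intro e' he'
    rw [if_neg]
    intro h
    exact he' (toMaps_left_injective _ (h.symm.trans he.symm))
  · intro Z hZ
    refine mul_eq_zero_of_right _ ((PMF.apply_eq_zero_iff _ _).2 fun h => ?_)
    obtain ⟨e', -, he'⟩ := (PMF.mem_support_map_iff _ _ _).1 h
    rw [← he', undefinedAt_toMaps] at hZ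
    exact hZ rfl

theorem domCard_set_ne {F : PartialMaps a b} {i i' : Fin (a - 1)} (h : i' ≠ i) (x : Fin b)
    (z : Option (Fin b)) : domCard (F.set i x z) i' = domCard F i' := by
  simp [domCard, set_apply, h]

theorem domCard_set {F : PartialMaps a b} {i : Fin (a - 1)} {x : Fin b} (h : F i x = none)
    (z : Fin b) : domCard (F.set i x (some z)) i = domCard F i + 1 := by
  unfold domCard
  rw [← Finset.card_insert_of_notMem (s := Finset.univ.filter fun x => F i x ≠ none) (a := x)
    (by simp [h])]
  congr 1
  ext x'
  by_cases hx : x' = x <;> simp [set_apply, hx]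

theorem sub_domCard (F : PartialMaps a b) (i : Fin (a - 1)) :
    b - domCard F i = (Finset.univ.filter fun x => F i x = none).card := by
  have := Finset.card_filter_add_card_filter_not (s := (Finset.univ : Finset (Fin b)))
    fun x => F i x = none
  rw [Finset.card_univ, Fintype.card_fin] at this
  unfold domCard
  simp only [ne_eq]
  omega

/-- One more defined value replaces a factor `p` by `1 - p`. It also multiplies the number of
injections by the number of values not yet taken, which equals the number of undefined arguments. -/
theorem maps_set {F : PartialMaps a b} {i : Fin (a - 1)} {x z : Fin b} (h : F i x = none)
    (hF : (F.set i x (some z)).Injective) (p : unitInterval) :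
    ENNReal.ofReal (1 - p) * maps a b p F =
      ENNReal.ofReal p * (Finset.univ.filter fun x => F i x = none).card *
        maps a b p (F.set i x (some z)) := by
  classical
  rw [maps_apply hF, maps_apply ((le_set h _).injective hF),
    ← Finset.mul_prod_erase Finset.univ (fun ν => PMF.coin p (undefinedAt F ν))
      (Finset.mem_univ (i, x)),
    ← Finset.mul_prod_erase Finset.univ
      (fun ν => PMF.coin p (undefinedAt (F.set i x (some z)) ν)) (Finset.mem_univ (i, x)),
    ← Finset.mul_prod_erase Finset.univ
      (fun i' => ((b.descFactorial (domCard F i') : ℕ) : ℝ≥0∞)⁻¹) (Finset.mem_univ i),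
    ← Finset.mul_prod_erase Finset.univ
      (fun i' => ((b.descFactorial (domCard (F.set i x (some z)) i') : ℕ) : ℝ≥0∞)⁻¹)
      (Finset.mem_univ i)]
  have e1 : ∏ ν ∈ Finset.univ.erase (i, x), PMF.coin p (undefinedAt (F.set i x (some z)) ν) =
      ∏ ν ∈ Finset.univ.erase (i, x), PMF.coin p (undefinedAt F ν) := by
    refine Finset.prod_congr rfl fun ν hν => ?_
    have hne := (Finset.mem_erase.1 hν).1
    rw [undefinedAt, undefinedAt, set_apply, if_neg]
    rintro ⟨h1, h2⟩
    exact hne (Prod.ext h1 h2)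
  have e2 : ∏ i' ∈ Finset.univ.erase i,
        ((b.descFactorial (domCard (F.set i x (some z)) i') : ℕ) : ℝ≥0∞)⁻¹ =
      ∏ i' ∈ Finset.univ.erase i, ((b.descFactorial (domCard F i') : ℕ) : ℝ≥0∞)⁻¹ :=
    Finset.prod_congr rfl fun i' hi' => by rw [domCard_set_ne (Finset.mem_erase.1 hi').1]
  have e3 : undefinedAt F (i, x) = true := by simp [undefinedAt, h]
  have e4 : undefinedAt (F.set i x (some z)) (i, x) = false := by simp [undefinedAt, set_self]
  rw [e1, e2, e3, e4, domCard_set h, Nat.descFactorial_succ, sub_domCard]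
  set m := (Finset.univ.filter fun x => F i x = none).card with hm
  have hm0 : (m : ℝ≥0∞) ≠ 0 := by
    rw [Nat.cast_ne_zero, hm, Finset.card_ne_zero]
    exact ⟨x, by simp [h]⟩
  rw [Nat.cast_mul, ENNReal.mul_inv (.inl hm0) (.inl (ENNReal.natCast_ne_top m)),
    PMF.coin_apply, PMF.coin_apply, if_pos rfl, if_neg Bool.false_ne_true]
  set A := ∏ ν ∈ Finset.univ.erase (i, x), PMF.coin p (undefinedAt F ν)
  set B := ∏ i' ∈ Finset.univ.erase i, ((b.descFactorial (domCard F i') : ℕ) : ℝ≥0∞)⁻¹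
  set D := ((b.descFactorial (domCard F i) : ℕ) : ℝ≥0∞)⁻¹
  calc ENNReal.ofReal (1 - p) * (ENNReal.ofReal p * A * (D * B))
      = (m * (m : ℝ≥0∞)⁻¹) * (ENNReal.ofReal (1 - p) * (ENNReal.ofReal p * A * (D * B))) := by
        rw [ENNReal.mul_inv_cancel hm0 (ENNReal.natCast_ne_top m), one_mul]
    _ = _ := by ring

/-- It is unlikely that many values of `f_i` are undefined. -/
theorem maps_undefined_le (p : unitInterval) (i : Fin (a - 1)) (K : ℕ) :
    (maps a b p).toOuterMeasure {F | K < (Finset.univ.filter fun x => F i x = none).card} ≤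
      (1 + ENNReal.ofReal p) ^ b * (2 ^ K)⁻¹ := by
  classical
  let cnt : (Fin (a - 1) × Fin b → Bool) → ℕ := fun Z =>
    (Finset.univ.filter fun x => Z (i, x) = true).card
  have h1 : {F : PartialMaps a b | K < (Finset.univ.filter fun x => F i x = none).card} =
      undefinedAt ⁻¹' {Z | K < cnt Z} := by
    ext F
    simp [cnt, undefinedAt]
  rw [h1, ← PMF.toOuterMeasure_map_apply, maps_map_undefinedAt, PMF.toOuterMeasure_apply_fintype]
  -- Markov's inequality is applied to `2 ^ cnt`, whose expectation factors over the nodes.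
  have h2 : ∀ Z : Fin (a - 1) × Fin b → Bool,
      (2 : ℝ≥0∞) ^ cnt Z = ∏ ν, if ν.1 = i ∧ Z ν = true then 2 else 1 := by
    intro Z
    rw [Finset.prod_ite, Finset.prod_const_one, mul_one, Finset.prod_const]
    congr 1
    refine Finset.card_bij (fun x _ => (i, x)) ?_ ?_ ?_
    · intro x hx
      simpa using hx
    · intro x _ x' _ hxx
      exact congrArg Prod.snd hxx
    · rintro ⟨i', x⟩ hν
      obtain ⟨rfl, hx⟩ := (Finset.mem_filter.1 hν).2
      exact ⟨x, by simpa using hx, rfl⟩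
  have h3 : ∑ Z : Fin (a - 1) × Fin b → Bool,
      (∏ ν, PMF.coin p (Z ν)) * (2 : ℝ≥0∞) ^ cnt Z = (1 + ENNReal.ofReal p) ^ b := by
    simp only [h2, ← Finset.prod_mul_distrib]
    have h := Finset.prod_univ_sum (fun _ : Fin (a - 1) × Fin b => (Finset.univ : Finset Bool))
      fun ν e => PMF.coin p e * if ν.1 = i ∧ e = true then 2 else 1
    rw [Fintype.piFinset_univ] at h
    rw [← h]
    have hs : ENNReal.ofReal (p : ℝ) + ENNReal.ofReal (1 - p) = 1 := by
      rw [← ENNReal.ofReal_add p.2.1 (sub_nonneg.2 p.2.2)]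
      simp
    have h4 : ∀ ν : Fin (a - 1) × Fin b,
        ∑ e, PMF.coin p e * (if ν.1 = i ∧ e = true then 2 else 1) =
          if ν.1 = i then 1 + ENNReal.ofReal p else 1 := by
      intro ν
      rw [Fintype.sum_bool, PMF.coin_apply, PMF.coin_apply]
      split_ifs with h5 <;> simp_all
      rw [← hs]
      ring
    have h5 : ∀ i' : Fin (a - 1), ∏ x : Fin b,
        (if ((i', x) : Fin (a - 1) × Fin b).1 = i then 1 + ENNReal.ofReal p else 1) =
          if i' = i then (1 + ENNReal.ofReal p) ^ b else 1 := by
      intro i'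
      by_cases hi : i' = i <;> simp [hi]
    rw [Finset.prod_congr rfl fun ν _ => h4 ν, Fintype.prod_prod_type,
      Finset.prod_congr rfl fun i' _ => h5 i', Finset.prod_ite_eq', if_pos (Finset.mem_univ i)]
  calc ∑ Z, ({Z | K < cnt Z} : Set _).indicator (PMF.independent fun _ => PMF.coin p) Z
      ≤ ∑ Z, ((∏ ν, PMF.coin p (Z ν)) * (2 : ℝ≥0∞) ^ cnt Z) * (2 ^ K)⁻¹ := by
        refine Finset.sum_le_sum fun Z _ => ?_
        rw [Set.indicator_apply]
        split_ifs with hZ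
        swap
        · exact zero_le
        rw [PMF.independent_apply, mul_assoc]
        refine le_mul_of_one_le_right' ?_
        rw [← ENNReal.mul_inv_cancel (a := 2 ^ K) (by simp) (by simp)]
        gcongr
        · norm_num
        · exact le_of_lt hZ
    _ = _ := by rw [← Finset.sum_mul, h3]

/-! ### Random labelled maps -/

/-- The distribution of random partial maps together with independent labels of all nodes. -/
noncomputable def labelledMaps (a b c : ℕ) [NeZero c] (p q : unitInterval) :
    PMF (LabelledMaps a b c) :=
  (maps a b p).bind fun F =>
    (PMF.independent fun _ : Node a b => label c q).map (Prod.mk F)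

theorem labelledMaps_apply {c : ℕ} [NeZero c] (p q : unitInterval) (S : LabelledMaps a b c) :
    labelledMaps a b c p q S = maps a b p S.1 * ∏ ν, label c q (S.2 ν) := by
  obtain ⟨F, κ⟩ := S
  rw [labelledMaps, PMF.bind_apply, tsum_eq_single F, PMF.map_apply, tsum_eq_single κ, if_pos rfl,
    PMF.independent_apply]
  · intro κ' h
    rw [if_neg]
    intro h'
    exact h (congrArg Prod.snd h').symm
  · intro F' h
    refine mul_eq_zero_of_right _ ((PMF.apply_eq_zero_iff _ _).2 fun h' => ?_)
    obtain ⟨κ', -, h1⟩ := (PMF.mem_support_map_iff _ _ _).1 h'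
    exact h (congrArg Prod.fst h1)

/-- Labels of nodes that begin no path are never read. Giving labels to all nodes makes the label
space the same for all maps, so that labels survive changes of the maps. -/
theorem dist_eq_map {c : ℕ} [NeZero c] (p q : unitInterval) :
    dist a b c p q = (labelledMaps a b c p q).map LabelledMaps.restriction := by
  classical
  rw [dist, labelledMaps, PMF.map_bind]
  congr 1
  funext F
  rw [PMF.map_comp, ← PMF.independent_map_comp (label c q)
    (⟨fun h => h.1, Subtype.val_injective⟩ : F.Head ↪ Node a b), PMF.map_comp]
  rfl

theorem labelledMaps_map_fst {c : ℕ} [NeZero c] (p q : unitInterval) :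
    (labelledMaps a b c p q).map Prod.fst = maps a b p := by
  rw [labelledMaps, PMF.map_bind]
  have : ∀ F : PartialMaps a b, PMF.map Prod.fst
      ((PMF.independent fun _ : Node a b => label c q).map (Prod.mk F)) = PMF.pure F := by
    intro F
    rw [PMF.map_comp]
    exact PMF.map_const _ _
  simp only [this, PMF.bind_pure]

/-- The weights given by the random labelled maps. -/
noncomputable def weighting (a b c : ℕ) [NeZero c] (p q : unitInterval) (K : ℕ) (ε : ℝ≥0∞)
    (hp : (p : ℝ) < 1) (hpK : ENNReal.ofReal p * K ≤ ε * ENNReal.ofReal (1 - p))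
    (hqc : ENNReal.ofReal q * c ≤ ε * ENNReal.ofReal (1 - q)) :
    LabelledMaps.Weighting a b c K ε where
  maps := maps a b p
  label := label c q
  maps_le F i x z h hF hK := by
    have h0 : ENNReal.ofReal (1 - p) ≠ 0 := by simpa using hp
    rw [← ENNReal.mul_le_mul_iff_right h0 ENNReal.ofReal_ne_top, maps_set h hF]
    calc _ ≤ ENNReal.ofReal p * K * maps a b p (F.set i x (some z)) := by gcongr
      _ ≤ ε * ENNReal.ofReal (1 - p) * maps a b p (F.set i x (some z)) := by gcongr
      _ = _ := by ring
  label_le z := by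
    rw [label_none, label_some, ← mul_assoc, ← div_eq_mul_inv]
    rwa [ENNReal.le_div_iff_mul_le (.inl (by simpa using NeZero.ne c))
      (.inl (ENNReal.natCast_ne_top c))]

theorem weighting_weight {c : ℕ} [NeZero c] (p q : unitInterval) (K : ℕ) (ε : ℝ≥0∞)
    (hp : (p : ℝ) < 1) (hpK : ENNReal.ofReal p * K ≤ ε * ENNReal.ofReal (1 - p))
    (hqc : ENNReal.ofReal q * c ≤ ε * ENNReal.ofReal (1 - q)) (S : LabelledMaps a b c) :
    (weighting a b c p q K ε hp hpK hqc).weight S = labelledMaps a b c p q S := by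
  rw [labelledMaps_apply]
  rfl

/-- Random restrictions are likely to decide all queries of a decision tree. -/
theorem labelledMaps_not_allOn_le {c : ℕ} [NeZero c] (p q : unitInterval) (K : ℕ) (ε : ℝ≥0∞)
    (hp : (p : ℝ) < 1) (hpK : ENNReal.ofReal p * K ≤ ε * ENNReal.ofReal (1 - p))
    (hqc : ENNReal.ofReal q * c ≤ ε * ENNReal.ofReal (1 - q)) {Q O : Type}
    {dnf : Q → Set (List (CPLSVar a b c × Bool))} {t : DecisionTree Q O} {r : ℕ} (hr : r < c)
    (ht : t.Forall fun q => ∀ u ∈ dnf q, u.length ≤ r) (ha : 0 < a) (hb : 0 < Nat.log 2 b)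
    (hbit : ∀ z z' : Fin b,
      (∀ j : Fin (Nat.log 2 b), z.val.testBit j = z'.val.testBit j) → z = z') :
    (labelledMaps a b c p q).toOuterMeasure {S | ¬ (S.1.Injective ∧
        t.AllOn (fun q => S.restriction.Decides (dnf q))
          (LabelledMaps.answers dnf S.restriction))} ≤
      a * ((1 + ENNReal.ofReal p) ^ b * (2 ^ K)⁻¹) +
        t.depth * ((1 + 2 * ε) ^ (2 * r) - 1) := by
  classical
  set μ := labelledMaps a b c p q with hμ
  -- Failures are split into maps that are not injective (a null event), maps that are not dense,
  -- and dense maps with an undecided query.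
  set A : Set (LabelledMaps a b c) := {S | ¬ S.1.Injective}
  set B : Set (LabelledMaps a b c) := Prod.fst ⁻¹' ⋃ i : Fin (a - 1),
    {F | K < (Finset.univ.filter fun x => F i x = none).card}
  set C : Set (LabelledMaps a b c) := {S | S.1.Injective ∧ LabelledMaps.Dense K S.1 ∧
    ¬ t.AllOn (fun q => S.restriction.Decides (dnf q))
      (LabelledMaps.answers dnf S.restriction)}
  have hA : μ.toOuterMeasure A = 0 := by
    rw [PMF.toOuterMeasure_apply_eq_zero_iff, Set.disjoint_left]
    intro S hS hS'
    rw [PMF.mem_support_iff, hμ, labelledMaps_apply, maps_eq_zero hS', zero_mul] at hS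
    exact hS rfl
  have hB : μ.toOuterMeasure B ≤ a * ((1 + ENNReal.ofReal p) ^ b * (2 ^ K)⁻¹) := by
    rw [← PMF.toOuterMeasure_map_apply, labelledMaps_map_fst]
    refine (MeasureTheory.measure_iUnion_fintype_le _ _).trans ?_
    refine (Finset.sum_le_sum fun i _ => maps_undefined_le p i K).trans ?_
    rw [Finset.sum_const, Finset.card_univ, Fintype.card_fin, nsmul_eq_mul]
    gcongr
    exact Nat.sub_le a 1
  have hC : μ.toOuterMeasure C ≤ t.depth * ((1 + 2 * ε) ^ (2 * r) - 1) := by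
    have hw := weighting_weight (a := a) (b := b) p q K ε hp hpK hqc
    have := LabelledMaps.sum_weight_not_allOn_le (W := weighting a b c p q K ε hp hpK hqc)
      hr ht ha hb hbit (by simp only [hw, PMF.sum_univ, le_refl])
    rw [PMF.toOuterMeasure_apply_fintype]
    simp only [hw, Finset.sum_filter] at this
    refine le_trans (le_of_eq (Finset.sum_congr rfl fun S _ => ?_)) this
    simp [Set.indicator_apply, C, hμ]
  have hsub : {S | ¬ (S.1.Injective ∧ t.AllOn (fun q => S.restriction.Decides (dnf q))
          (LabelledMaps.answers dnf S.restriction))} ⊆ A ∪ (B ∪ C) := by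
    intro S hS
    by_cases h1 : S.1.Injective
    · by_cases h2 : LabelledMaps.Dense K S.1
      · exact .inr (.inr ⟨h1, h2, fun h3 => hS ⟨h1, h3⟩⟩)
      · refine .inr (.inl ?_)
        obtain ⟨i, hi⟩ := not_forall.1 h2
        exact Set.mem_iUnion.2 ⟨i, not_le.1 hi⟩
    · exact .inl h1
  calc μ.toOuterMeasure _ ≤ μ.toOuterMeasure (A ∪ (B ∪ C)) := μ.toOuterMeasure.mono hsub
    _ ≤ μ.toOuterMeasure A + (μ.toOuterMeasure B + μ.toOuterMeasure C) :=
      (MeasureTheory.measure_union_le _ _).trans (by gcongr; exact MeasureTheory.measure_union_le _ _)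
    _ ≤ _ := by rw [hA, zero_add]; exact add_le_add hB hC

end RandomRestriction

/-! ### The decision tree of a composed precomputation -/

open Polynomial in
/-- Precomputations of `f_x(g_x(v))` are given by decision trees whose depth and whose terms are
polynomially bounded in the length of the inputs. -/
theorem RetractionWPHP.exists_tree (P : RetractionWPHP) : ∃ T R : Polynomial ℕ,
    ∀ {a b c : ℕ} (code : CPLSVar a b c ↪ List Bool) (rest : PartialOracle) (x v l : ℕ),
      v < 2 * x → Nat.size (2 * x) ≤ l →
      ∃ (Q O : Type) (dnf : Q → Set (List (CPLSVar a b c × Bool))) (t : DecisionTree Q O),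
        t.depth ≤ T.eval l ∧ t.Forall (fun q => ∀ u ∈ dnf q, u.length ≤ R.eval l) ∧
        ∀ ρ : Restriction a b c,
          t.AllOn (fun q => ρ.Decides (dnf q)) (LabelledMaps.answers dnf ρ) →
          ∃ u < x, (∃ w, P.g.Fixes code rest ρ w x v u) ∧
            ∃ w z, P.f.Fixes code rest ρ w x u z := by
  obtain ⟨pg, hpg⟩ := P.g.base_polyTime
  obtain ⟨pf, hpf⟩ := P.f.base_polyTime
  obtain ⟨vg, hvg⟩ := P.g.verifier_polyTime
  obtain ⟨vf, hvf⟩ := P.f.verifier_polyTime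
  -- Two inputs of length at most `l` each. The same polynomial bounds the depth and the lengths of
  -- the queries.
  let T : ℕ[X] := (pg + pf).comp (C 2 * X)
  refine ⟨T, vg.comp (T + P.g.witnessBound.comp T) + vf.comp (T + P.f.witnessBound.comp T),
    fun {a b c} code rest x v l hv hl => ?_⟩
  have hx : 0 < x := by omega
  have hlen : ∀ y, y ≤ 2 * x → (Nat.bits y).length ≤ l := fun y hy => by
    rw [Nat.size_eq_bits_len]
    exact (Nat.size_le_size hy).trans hl
  have hTg : ∀ y y', y ≤ 2 * x → y' ≤ 2 * x →
      pg.eval ((Nat.bits y).length + (Nat.bits y').length) ≤ pg.eval (2 * l) := fun y y' h h' =>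
    eval_nat_mono pg (by have := hlen y h; have := hlen y' h'; omega)
  have hTf : ∀ y y', y ≤ 2 * x → y' ≤ 2 * x →
      pf.eval ((Nat.bits y).length + (Nat.bits y').length) ≤ pf.eval (2 * l) := fun y y' h h' =>
    eval_nat_mono pf (by have := hlen y h; have := hlen y' h'; omega)
  have hT : T.eval l = pg.eval (2 * l) + pf.eval (2 * l) := by simp [T]
  let tg : DecisionTree (List Bool) P.g.base.Config :=
    P.g.base.tree (pg.eval ((Nat.bits x).length + (Nat.bits v).length))
      (P.g.base.init (Nat.bits x) (Nat.bits v))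
  let tf : ℕ → DecisionTree (List Bool) P.f.base.Config := fun u =>
    P.f.base.tree (pf.eval ((Nat.bits x).length + (Nat.bits u).length))
      (P.f.base.init (Nat.bits x) (Nat.bits u))
  let out : P.g.base.Config → ℕ := fun d => natOfBits (d.stack .output)
  -- On branches that are not precomputations the output of `g` may be too large; the default `0`
  -- keeps the second computation polynomially bounded. On fixed branches the default is not used.
  let out' : P.g.base.Config → ℕ := fun d => if out d < x then out d else 0
  have hout' : ∀ d, out' d < x := fun d => by
    simp only [out']
    split_ifs with h
    · exact h
    · exact hx
  let dnf : Bool × List Bool → Set (List (CPLSVar a b c × Bool)) := fun q =>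
    if q.1 then P.g.terms code rest q.2 else P.f.terms code rest q.2
  refine ⟨Bool × List Bool, P.f.base.Config, dnf,
    (tg.map (Prod.mk true)).bind fun d => (tf (out' d)).map (Prod.mk false), ?_, ?_, ?_⟩
  · rw [hT]
    refine (DecisionTree.depth_bind_le _ _ (pf.eval (2 * l)) fun d => ?_).trans
      (Nat.add_le_add_right ?_ _)
    · rw [DecisionTree.depth_map]
      exact (OracleMachine.depth_tree_le _ _).trans
        (hTf _ _ (by omega) (by have := hout' d; omega))
    · rw [DecisionTree.depth_map]
      exact (OracleMachine.depth_tree_le _ _).trans (hTg _ _ (by omega) (by omega))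
  · simp only [eval_add, eval_comp]
    refine DecisionTree.Forall.bind (DecisionTree.Forall.map
      (OracleMachine.forall_tree_length_le (T.eval l) _ _ ?_) fun q hq u hu => ?_)
      fun d => DecisionTree.Forall.map
        (OracleMachine.forall_tree_length_le (T.eval l) _ _ ?_) fun q hq u hu => ?_
    · have := hTg x v (by omega) (by omega)
      simp only [OracleMachine.init, List.length_nil]
      omega
    · exact (P.g.length_le_of_mem_terms code rest hvg hq hu).trans (Nat.le_add_right _ _)
    · have := hTf x (out' d) (by omega) (by have := hout' d; omega)
      simp only [OracleMachine.init, List.length_nil]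
      omega
    · exact (P.f.length_le_of_mem_terms code rest hvf hq hu).trans (Nat.le_add_left _ _)
  · intro ρ h
    obtain ⟨h1, h2⟩ := DecisionTree.allOn_bind.1 h
    rw [DecisionTree.allOn_map] at h1 h2
    rw [DecisionTree.eval_map] at h2
    obtain ⟨w, hw⟩ := P.g.fixes_of_allOn code rest ρ x v _ (hpg _ _)
      (ans := fun q => LabelledMaps.answers dnf ρ (true, q))
      (fun q => LabelledMaps.answers_eq_true) h1
    have hu := P.g_lt _ _ _ _ _ hv hw.1
    have he : out' (tg.eval fun q => LabelledMaps.answers dnf ρ (true, q)) =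
      out (tg.eval fun q => LabelledMaps.answers dnf ρ (true, q)) := if_pos hu
    rw [he] at h2
    obtain ⟨w', hw'⟩ := P.f.fixes_of_allOn code rest ρ x _ _ (hpf _ _)
      (ans := fun q => LabelledMaps.answers dnf ρ (false, q))
      (fun q => LabelledMaps.answers_eq_true) h2
    exact ⟨_, hu, ⟨w, hw⟩, w', _, hw'⟩

/-! ### Averaging over the arguments -/

open Classical in
-- Markov's inequality: outside the event at least `x` of the `2x` arguments are bad, while the
-- expected number of bad ones is at most `2xη`.
theorem PMF.le_toOuterMeasure_lt_card {α : Type} [Fintype α] (μ : PMF α) (G : ℕ → Set α) {x : ℕ}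
    (hx : 0 < x) {η : ℝ≥0∞} (h : ∀ v < 2 * x, μ.toOuterMeasure (G v)ᶜ ≤ η) :
    1 ≤ μ.toOuterMeasure {ω | x < ((Finset.range (2 * x)).filter fun v => ω ∈ G v).card} +
      2 * η := by
  set A : Set α := {ω | x < ((Finset.range (2 * x)).filter fun v => ω ∈ G v).card} with hA
  have h1 : μ.toOuterMeasure A + μ.toOuterMeasure Aᶜ = 1 := by
    rw [PMF.toOuterMeasure_apply_fintype, PMF.toOuterMeasure_apply_fintype,
      ← Finset.sum_add_distrib, ← μ.sum_univ]
    refine Finset.sum_congr rfl fun ω _ => ?_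
    rw [← Pi.add_apply, Set.indicator_self_add_compl]
  have hx0 : (x : ℝ≥0∞) ≠ 0 := by exact_mod_cast hx.ne'
  have h2 : (x : ℝ≥0∞) * μ.toOuterMeasure Aᶜ ≤ x * (2 * η) := by
    calc (x : ℝ≥0∞) * μ.toOuterMeasure Aᶜ
        = ∑ ω, x * Aᶜ.indicator μ ω := by
          rw [PMF.toOuterMeasure_apply_fintype, Finset.mul_sum]
      _ ≤ ∑ ω, ∑ v ∈ Finset.range (2 * x), (G v)ᶜ.indicator μ ω := by
          refine Finset.sum_le_sum fun ω _ => ?_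
          simp only [Set.indicator_apply, Set.mem_compl_iff]
          rw [← Finset.sum_filter, Finset.sum_const, nsmul_eq_mul]
          split_ifs with hω
          · simp
          · gcongr
            have := Finset.card_filter_add_card_filter_not (s := Finset.range (2 * x))
              fun v => ω ∈ G v
            rw [Finset.card_range] at this
            have hω' : ¬ x < ((Finset.range (2 * x)).filter fun v => ω ∈ G v).card := hω
            omega
      _ = ∑ v ∈ Finset.range (2 * x), μ.toOuterMeasure (G v)ᶜ := by
          rw [Finset.sum_comm]
          exact Finset.sum_congr rfl fun v _ => by rw [PMF.toOuterMeasure_apply_fintype]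
      _ ≤ ∑ v ∈ Finset.range (2 * x), η :=
          Finset.sum_le_sum fun v hv => h v (Finset.mem_range.1 hv)
      _ = x * (2 * η) := by
          rw [Finset.sum_const, Finset.card_range, nsmul_eq_mul]
          push_cast
          ring
  rw [ENNReal.mul_le_mul_iff_right hx0 (ENNReal.natCast_ne_top x)] at h2
  rw [← h1]
  gcongr

/-- If more than `x` of the `2x` arguments have fixed precomputations, then one of them is not
mapped to itself. -/
theorem RetractionWPHP.exists_forces (P : RetractionWPHP) {a b c : ℕ}
    {code : CPLSVar a b c ↪ List Bool} {rest : PartialOracle} {ρ : Restriction a b c}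
    {x : ℕ} {V : Finset ℕ} (hV : V ⊆ Finset.range (2 * x)) (hcard : x < V.card)
    (h : ∀ v ∈ V, ∃ u < x, (∃ w, P.g.Fixes code rest ρ w x v u) ∧
      ∃ w z, P.f.Fixes code rest ρ w x u z) :
    ∃ v v', v < 2 * x ∧ v ≠ v' ∧ P.Forces code rest ρ x v v' := by
  choose! u hu hg hf using h
  obtain ⟨v₁, hv₁, v₂, hv₂, hne, he⟩ := Finset.exists_ne_map_eq_of_card_lt_of_maps_to
    (t := Finset.range x) (by rwa [Finset.card_range]) fun v hv =>
      Finset.mem_coe.2 (Finset.mem_range.2 (hu v hv))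
  obtain ⟨w₁, h₁⟩ := hg v₁ hv₁
  obtain ⟨w₂, h₂⟩ := hg v₂ hv₂
  obtain ⟨w', z, h'⟩ := hf v₁ hv₁
  -- Both arguments have the value `u v₁` under `g`, where the output `z` of `f` is fixed; `z`
  -- cannot equal both of them.
  by_cases hz : v₁ = z
  · refine ⟨v₂, z, Finset.mem_range.1 (hV hv₂), fun h => hne (hz.trans h.symm), u v₁, w₂, w', ?_, h'⟩
    rw [he]
    exact h₂
  · exact ⟨v₁, z, Finset.mem_range.1 (hV hv₁), hz, u v₁, w₁, w', h₁, h'⟩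

/-- A lower bound for the probability that the retraction is seen to fail. -/
theorem RandomRestriction.le_dist_forces (P : RetractionWPHP) {T R : Polynomial ℕ}
    (hTR : ∀ {a b c : ℕ} (code : CPLSVar a b c ↪ List Bool) (rest : PartialOracle) (x v l : ℕ),
      v < 2 * x → Nat.size (2 * x) ≤ l →
      ∃ (Q O : Type) (dnf : Q → Set (List (CPLSVar a b c × Bool))) (t : DecisionTree Q O),
        t.depth ≤ T.eval l ∧ t.Forall (fun q => ∀ u ∈ dnf q, u.length ≤ R.eval l) ∧
        ∀ ρ : Restriction a b c,
          t.AllOn (fun q => ρ.Decides (dnf q)) (LabelledMaps.answers dnf ρ) →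
          ∃ u < x, (∃ w, P.g.Fixes code rest ρ w x v u) ∧
            ∃ w z, P.f.Fixes code rest ρ w x u z)
    {a b c : ℕ} [NeZero c] (p q : unitInterval) (K : ℕ) (ε : ℝ≥0∞)
    (hp : (p : ℝ) < 1) (hpK : ENNReal.ofReal p * K ≤ ε * ENNReal.ofReal (1 - p))
    (hqc : ENNReal.ofReal q * c ≤ ε * ENNReal.ofReal (1 - q)) (ha : 0 < a)
    (hb : 0 < Nat.log 2 b)
    (hbit : ∀ z z' : Fin b, (∀ j : Fin (Nat.log 2 b), z.val.testBit j = z'.val.testBit j) → z = z')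
    (code : CPLSVar a b c ↪ List Bool) (rest : PartialOracle) {x l : ℕ} (hx : 0 < x)
    (hl : Nat.size (2 * x) ≤ l) (hr : R.eval l < c) :
    1 ≤ (dist a b c p q).toOuterMeasure
        {ρ | ∃ v v' : ℕ, v < 2 * x ∧ v ≠ v' ∧ P.Forces code rest ρ x v v'} +
      2 * (a * ((1 + ENNReal.ofReal p) ^ b * (2 ^ K)⁻¹) +
        T.eval l * ((1 + 2 * ε) ^ (2 * R.eval l) - 1)) := by
  classical
  let G : ℕ → Set (LabelledMaps a b c) := fun v => {S | S.1.Injective ∧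
    ∃ u < x, (∃ w, P.g.Fixes code rest S.restriction w x v u) ∧
      ∃ w z, P.f.Fixes code rest S.restriction w x u z}
  rw [dist_eq_map, PMF.toOuterMeasure_map_apply]
  refine ((labelledMaps a b c p q).le_toOuterMeasure_lt_card G hx fun v hv => ?_).trans
    (add_le_add_left (MeasureTheory.measure_mono fun S hS => ?_) _)
  · obtain ⟨Q, O, dnf, t, hdepth, hlen, ht⟩ := hTR code rest x v l hv hl
    have hsub : (G v)ᶜ ⊆ {S | ¬ (S.1.Injective ∧
        t.AllOn (fun q => S.restriction.Decides (dnf q))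
          (LabelledMaps.answers dnf S.restriction))} :=
      fun S hS h => hS ⟨h.1, ht _ h.2⟩
    refine le_trans (MeasureTheory.measure_mono hsub)
      ((labelledMaps_not_allOn_le p q K ε hp hpK hqc hr hlen ha hb hbit).trans ?_)
    gcongr
  · have hS' : x < ((Finset.range (2 * x)).filter fun v => S ∈ G v).card := by
      convert Set.mem_ofPred_eq.mp hS
    exact P.exists_forces (Finset.filter_subset _ _) hS' fun v hv => (Finset.mem_filter.1 hv).2.2

/-! ### Estimates -/

theorem polynomial_isLittleO_two_rpow (A : Polynomial ℕ) {γ : ℝ} (hγ : 0 < γ) :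
    (fun m : ℕ => ((A.eval m : ℕ) : ℝ)) =o[atTop] fun m : ℕ => (2 : ℝ) ^ (γ * m) := by
  have h : ∀ m : ℕ, (2 : ℝ) ^ (γ * m) = ((2 : ℝ) ^ γ) ^ m := fun m => by
    rw [Real.rpow_mul (by norm_num), Real.rpow_natCast]
  simp only [h, Polynomial.eval_eq_sum_range, Nat.cast_sum, Nat.cast_mul, Nat.cast_pow]
  have hi : ∀ i ∈ Finset.range (A.natDegree + 1),
      (fun m : ℕ => (A.coeff i : ℝ) * (m : ℝ) ^ i) =o[atTop] fun m : ℕ => ((2 : ℝ) ^ γ) ^ m :=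
    fun i _ => (isLittleO_pow_const_const_pow_of_one_lt i
      (Real.one_lt_rpow (by norm_num) hγ)).const_mul_left _
  exact Asymptotics.IsLittleO.fun_sum hi

theorem eventually_polynomial_le (A : Polynomial ℕ) {γ : ℝ} (hγ : 0 < γ) :
    ∀ᶠ m : ℕ in atTop, ((A.eval m : ℕ) : ℝ) ≤ (2 : ℝ) ^ (γ * m) := by
  filter_upwards [(polynomial_isLittleO_two_rpow A hγ).bound one_pos] with m hm
  rwa [one_mul, Real.norm_of_nonneg (Nat.cast_nonneg _),
    Real.norm_of_nonneg (Real.rpow_nonneg (by norm_num) _)] at hm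

theorem one_add_pow_le {y : ℝ} (hy : 0 ≤ y) {N : ℕ} (h : N * y ≤ 1) :
    (1 + y) ^ N ≤ 1 + 2 * (N * y) := by
  have h0 : 0 ≤ N * y := by positivity
  calc (1 + y) ^ N ≤ (Real.exp y) ^ N := by
        gcongr
        rw [add_comm]
        exact Real.add_one_le_exp y
    _ = Real.exp (N * y) := by rw [← Real.exp_nat_mul]
    _ ≤ 1 + N * y + (N * y) ^ 2 := by
        have := (abs_le.1 (Real.abs_exp_sub_one_sub_id_le
          (by rwa [abs_of_nonneg h0] : |(N : ℝ) * y| ≤ 1))).2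
        linarith
    _ ≤ 1 + 2 * (N * y) := by nlinarith

/-- Here `n = 2^(7m)`, `p = 2^(-4m)`, and the threshold `2^(3m+2)` is four times the mean `pn`. With
`N = 2^(3m)` the moment is at most `e^N ≤ 4^N`, against `2^(4N) = 16^N`; the gain `4^N` absorbs the
factor `n * 2^m`. -/
theorem tail_le (m : ℕ) :
    (2 : ℝ) ^ (7 * m) * ((1 + (2 ^ (4 * m))⁻¹) ^ (2 ^ (7 * m)) * (2 ^ (2 ^ (3 * m + 2)))⁻¹) ≤
      (2 ^ m)⁻¹ := by
  have h1 : (1 + ((2 : ℝ) ^ (4 * m))⁻¹) ^ (2 ^ (7 * m)) ≤ 4 ^ (2 ^ (3 * m)) := by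
    calc (1 + ((2 : ℝ) ^ (4 * m))⁻¹) ^ (2 ^ (7 * m))
        ≤ (Real.exp ((2 : ℝ) ^ (4 * m))⁻¹) ^ (2 ^ (7 * m)) := by
          gcongr
          rw [add_comm]
          exact Real.add_one_le_exp _
      _ = Real.exp 1 ^ (2 ^ (3 * m)) := by
          rw [← Real.exp_nat_mul, ← Real.exp_nat_mul]
          congr 1
          rw [show 7 * m = 3 * m + 4 * m by ring, pow_add]
          push_cast
          field_simp
      _ ≤ 4 ^ (2 ^ (3 * m)) := by
          gcongr
          have := Real.exp_one_lt_d9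
          linarith
  have h2 : (2 : ℝ) ^ (2 ^ (3 * m + 2)) = 4 ^ (2 ^ (3 * m)) * 4 ^ (2 ^ (3 * m)) := by
    rw [← mul_pow, pow_add, mul_comm, pow_mul]
    norm_num
  have h3 : ∀ j, j * 4 ≤ 2 ^ (3 * j) := by
    intro j
    induction j with
    | zero => simp
    | succ j ih =>
      rw [mul_add, pow_add]
      have := Nat.one_le_two_pow (n := 3 * j)
      omega
  have h4 : (2 : ℝ) ^ (7 * m) * 2 ^ m ≤ 4 ^ (2 ^ (3 * m)) := by
    rw [← pow_add, show (4 : ℝ) = 2 ^ 2 by norm_num, ← pow_mul]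
    exact pow_le_pow_right₀ (by norm_num) (by have := h3 m; omega)
  generalize (1 + ((2 : ℝ) ^ (4 * m))⁻¹) ^ (2 ^ (7 * m)) = y at h1 ⊢
  rw [h2, ← div_eq_mul_inv, ← mul_div_assoc, div_le_iff₀ (by positivity), inv_mul_eq_div,
    le_div_iff₀ (by positivity), mul_right_comm]
  exact (mul_le_mul_of_nonneg_left h1 (by positivity)).trans
    (mul_le_mul_of_nonneg_right h4 (by positivity))

theorem natCast_rpow (m : ℕ) (y : ℝ) :
    (((2 ^ m) ^ 7 : ℕ) : ℝ) ^ y = 2 ^ (7 * y * m) := by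
  push_cast
  rw [← pow_mul, ← Real.rpow_natCast, ← Real.rpow_mul (by norm_num)]
  congr 1
  push_cast
  ring

theorem two_rpow_neg_mul (m k : ℕ) : (2 : ℝ) ^ (-(k : ℝ) * m) = (2 ^ (k * m))⁻¹ := by
  rw [neg_mul, Real.rpow_neg (by norm_num), ← Nat.cast_mul, Real.rpow_natCast]

/-! ### The main theorem: choice of the parameters -/

theorem mainTheorem9 (P : RetractionWPHP) (s : ℕ → ℕ) (hs : QuasiPolynomial s)
    (hs_pos : ∀ᶠ n in atTop, 0 < s n) (δ : ℝ) (hδ : δ < 1 / 7) :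
    ∀ᶠ n : ℕ in atTop, ∀ m : ℕ, n = (2 ^ m) ^ 7 →
      ∀ p q : unitInterval, (p : ℝ) = (n : ℝ) ^ (-(4 / 7) : ℝ) →
        (q : ℝ) = (n : ℝ) ^ (-(2 / 7) : ℝ) →
      ∀ (code : CPLSVar n n (2 ^ m) ↪ List Bool) (rest : PartialOracle),
        ENNReal.ofReal (1 - 3 * (n : ℝ) ^ (-δ)) ≤
          (RandomRestriction.dist n n (2 ^ m) p q).toOuterMeasure
            {ρ | ∃ v v' : ℕ, v < 2 * s n ∧ v ≠ v' ∧ P.Forces code rest ρ (s n) v v'} := by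
  obtain ⟨T, R, hTR⟩ := P.exists_tree
  obtain ⟨k, hk⟩ := hs
  -- Since `log n = 7m`, this bounds the length of `2 * s n`: one extra bit for the factor two, and
  -- one for the strict inequality in `Nat.size_le`.
  let l : Polynomial ℕ := (7 * Polynomial.X) ^ k + 2
  have hl : ∀ m : ℕ, l.eval m = (7 * m) ^ k + 2 := fun m => by simp [l]
  -- The error for one argument is at most `(64tr + 1) / 2^m`, and averaging doubles it. The summand
  -- `32r` keeps `2r * 2ε` at most one, as `one_add_pow_le` requires, and gives `r < c`.
  let A : Polynomial ℕ := 128 * T.comp l * R.comp l + 2 + 32 * R.comp l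
  have hA : ∀ m : ℕ, A.eval m =
      128 * T.eval (l.eval m) * R.eval (l.eval m) + 2 + 32 * R.eval (l.eval m) := fun m => by
    simp [A, Polynomial.eval_comp]
  -- The exponent `1` yields the bound `2^m`, and `1 - 7δ` yields the bound `2^m * n^(-δ)`; the
  -- latter is where `δ < 1/7` is needed.
  have hγ : 0 < min 1 (1 - 7 * δ) := lt_min one_pos (by linarith)
  obtain ⟨M, hM⟩ := eventually_atTop.1 (eventually_polynomial_le A hγ)
  filter_upwards [hk, hs_pos, eventually_ge_atTop ((2 ^ (M + 1)) ^ 7)] with n hkn hn hMn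
  rintro m rfl p q hp hq code rest
  have hm : M + 1 ≤ m := by
    rwa [Nat.pow_le_pow_iff_left (by norm_num), Nat.pow_le_pow_iff_right (by norm_num)] at hMn
  have hm1 : 1 ≤ m := by omega
  have hAm := hM m (by omega)
  rw [hA] at hAm
  set L := l.eval m
  set t := T.eval L
  set r := R.eval L
  have hγ1 : (2 : ℝ) ^ (min 1 (1 - 7 * δ) * m) ≤ 2 ^ m := by
    rw [← Real.rpow_natCast 2 m]
    refine Real.rpow_le_rpow_of_exponent_le (by norm_num) ?_
    exact mul_le_of_le_one_left (Nat.cast_nonneg m) (min_le_left _ _)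
  have hγ2 : (2 : ℝ) ^ (min 1 (1 - 7 * δ) * m) ≤ 2 ^ m * 2 ^ (7 * -δ * m) := by
    rw [← Real.rpow_natCast 2 m, ← Real.rpow_add (by norm_num)]
    refine Real.rpow_le_rpow_of_exponent_le (by norm_num) ?_
    have : min 1 (1 - 7 * δ) * m ≤ (1 - 7 * δ) * m := by
      gcongr
      exact min_le_right _ _
    linarith
  push_cast at hAm
  have ht0 : (0 : ℝ) ≤ t := Nat.cast_nonneg t
  have hr0 : (0 : ℝ) ≤ r := Nat.cast_nonneg r
  have htr0 : (0 : ℝ) ≤ 128 * t * r := by positivity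
  have h2m : (2 : ℝ) ≤ 2 ^ m := by
    simpa using pow_le_pow_right₀ (by norm_num : (1 : ℝ) ≤ 2) hm1
  have h2m0 : (0 : ℝ) < 2 ^ m := by positivity
  have hr32 : 32 * (r : ℝ) ≤ 2 ^ m := by linarith
  have hp' : (p : ℝ) = (2 ^ (4 * m))⁻¹ := by
    rw [hp, natCast_rpow, ← two_rpow_neg_mul]
    norm_num
  have hq' : (q : ℝ) = (2 ^ (2 * m))⁻¹ := by
    rw [hq, natCast_rpow, ← two_rpow_neg_mul]
    norm_num
  have hhalf : ∀ j, 1 ≤ j → ((2 : ℝ) ^ (j * m))⁻¹ ≤ 1 / 2 := fun j hj => by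
    rw [one_div]
    gcongr
    calc (2 : ℝ) ≤ 2 ^ m := h2m
      _ ≤ 2 ^ (j * m) := pow_le_pow_right₀ (by norm_num) (Nat.le_mul_of_pos_left m hj)
  have hp2 : (p : ℝ) ≤ 1 / 2 := hp' ▸ hhalf 4 (by norm_num)
  have hq2 : (q : ℝ) ≤ 1 / 2 := hq' ▸ hhalf 2 (by norm_num)
  have hε0 : (0 : ℝ) ≤ 8 * (2 ^ m)⁻¹ := by positivity
  -- With `K = 2^(3m+2)` one has `pK = 4 / 2^m`. Since `1 - p ≥ 1/2`, the choice `ε = 8 / 2^m`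
  -- suffices; for the colours `qc = 1 / 2^m` is smaller still.
  have hpK : ENNReal.ofReal p * (2 ^ (3 * m + 2) : ℕ) ≤
      ENNReal.ofReal (8 * (2 ^ m)⁻¹) * ENNReal.ofReal (1 - p) := by
    rw [← ENNReal.ofReal_natCast, ← ENNReal.ofReal_mul p.2.1, ← ENNReal.ofReal_mul hε0]
    refine ENNReal.ofReal_le_ofReal ?_
    have : (p : ℝ) * (2 ^ (3 * m + 2) : ℕ) = 4 * (2 ^ m)⁻¹ := by
      rw [hp', show 4 * m = 3 * m + m by ring, pow_add, pow_add]
      push_cast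
      field_simp
    rw [this]
    nlinarith
  have hqc : ENNReal.ofReal q * (2 ^ m : ℕ) ≤
      ENNReal.ofReal (8 * (2 ^ m)⁻¹) * ENNReal.ofReal (1 - q) := by
    rw [← ENNReal.ofReal_natCast, ← ENNReal.ofReal_mul q.2.1, ← ENNReal.ofReal_mul hε0]
    refine ENNReal.ofReal_le_ofReal ?_
    have : (q : ℝ) * (2 ^ m : ℕ) = (2 ^ m)⁻¹ := by
      rw [hq', two_mul, pow_add]
      push_cast
      field_simp
    rw [this]
    nlinarith
  have hlog : Nat.log 2 ((2 ^ m) ^ 7) = 7 * m := by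
    rw [← pow_mul, Nat.log_pow (by norm_num), mul_comm]
  have hbit : ∀ z z' : Fin ((2 ^ m) ^ 7),
      (∀ j : Fin (Nat.log 2 ((2 ^ m) ^ 7)), z.val.testBit j = z'.val.testBit j) → z = z' := by
    intro z z' h
    refine Fin.ext (Nat.eq_of_testBit_eq fun j => ?_)
    by_cases hj : j < 7 * m
    · exact h ⟨j, by rwa [hlog]⟩
    · have hpow : (2 ^ m) ^ 7 ≤ 2 ^ j := by
        rw [← pow_mul]
        exact Nat.pow_le_pow_right (by norm_num) (by omega)
      rw [Nat.testBit_lt_two_pow (z.2.trans_le hpow), Nat.testBit_lt_two_pow (z'.2.trans_le hpow)]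
  have hsize : Nat.size (2 * s ((2 ^ m) ^ 7)) ≤ L := by
    rw [hlog] at hkn
    have hpow : 2 ^ ((7 * m) ^ k + 2) = 2 ^ (7 * m) ^ k * 4 := pow_add 2 _ 2
    rw [Nat.size_le, show L = _ from hl m, hpow]
    omega
  have hrc : r < 2 ^ m := by
    have : (r : ℝ) < (2 ^ m : ℕ) := by
      push_cast
      linarith
    exact_mod_cast this
  have hmain := RandomRestriction.le_dist_forces P hTR p q (2 ^ (3 * m + 2))
    (ENNReal.ofReal (8 * (2 ^ m)⁻¹)) (by linarith) hpK hqc (by positivity)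
    (by rw [hlog]; omega) hbit code rest hn hsize hrc
  have hη : ((((2 ^ m) ^ 7 : ℕ) : ℝ≥0∞) *
        ((1 + ENNReal.ofReal p) ^ ((2 ^ m) ^ 7) * (2 ^ (2 ^ (3 * m + 2)))⁻¹) +
      t * ((1 + 2 * ENNReal.ofReal (8 * (2 ^ m)⁻¹)) ^ (2 * r) - 1)) ≤
      ENNReal.ofReal ((64 * t * r + 1) * (2 ^ m)⁻¹) := by
    have e1 : (((2 ^ m) ^ 7 : ℕ) : ℝ≥0∞) *
        ((1 + ENNReal.ofReal p) ^ ((2 ^ m) ^ 7) * (2 ^ (2 ^ (3 * m + 2)))⁻¹) ≤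
        ENNReal.ofReal ((2 ^ m)⁻¹) := by
      refine le_trans (le_of_eq ?_) (ENNReal.ofReal_le_ofReal (tail_le m))
      rw [ENNReal.ofReal_mul (by positivity), ENNReal.ofReal_mul (by positivity),
        ENNReal.ofReal_pow (by positivity), ENNReal.ofReal_pow (by positivity),
        ENNReal.ofReal_inv_of_pos (by positivity), ENNReal.ofReal_pow (by positivity),
        ENNReal.ofReal_add (by norm_num) (by positivity), ← hp', ENNReal.ofReal_one,
        ENNReal.ofReal_ofNat, ← pow_mul, mul_comm m 7]
      push_cast
      rfl
    have e2 : (1 + 2 * ENNReal.ofReal (8 * (2 ^ m)⁻¹)) ^ (2 * r) - 1 ≤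
        ENNReal.ofReal (64 * r * (2 ^ m)⁻¹) := by
      have h0 : (1 + 2 * ENNReal.ofReal (8 * (2 ^ m)⁻¹)) =
          ENNReal.ofReal (1 + 16 * (2 ^ m)⁻¹) := by
        rw [ENNReal.ofReal_add (by norm_num) (by positivity), ENNReal.ofReal_one,
          show (16 : ℝ) * (2 ^ m)⁻¹ = 2 * (8 * (2 ^ m)⁻¹) by ring,
          ENNReal.ofReal_mul (p := 2) (by norm_num), ENNReal.ofReal_ofNat]
      rw [tsub_le_iff_left, h0, ← ENNReal.ofReal_pow (by positivity), ← ENNReal.ofReal_one,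
        ← ENNReal.ofReal_add (by norm_num) (by positivity)]
      refine ENNReal.ofReal_le_ofReal ((one_add_pow_le (by positivity) ?_).trans (le_of_eq ?_))
      · push_cast
        rw [show 2 * (r : ℝ) * (16 * (2 ^ m)⁻¹) = 32 * r / 2 ^ m by ring]
        exact div_le_one_of_le₀ hr32 h2m0.le
      · push_cast
        ring
    calc _ ≤ ENNReal.ofReal ((2 ^ m)⁻¹) + t * ENNReal.ofReal (64 * r * (2 ^ m)⁻¹) := by gcongr
      _ = _ := by
        rw [← ENNReal.ofReal_natCast t, ← ENNReal.ofReal_mul ht0,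
          ← ENNReal.ofReal_add (by positivity) (by positivity)]
        congr 1
        ring
  -- The choice of `A` gives `128tr + 2 ≤ 2^m * n^(-δ)`, so the constant `3` leaves room to spare.
  have hfin : 2 * ENNReal.ofReal ((64 * t * r + 1) * (2 ^ m)⁻¹) ≤
      ENNReal.ofReal (3 * (((2 ^ m) ^ 7 : ℕ) : ℝ) ^ (-δ)) := by
    rw [natCast_rpow, ← ENNReal.ofReal_ofNat, ← ENNReal.ofReal_mul (by norm_num)]
    refine ENNReal.ofReal_le_ofReal ?_
    rw [← mul_assoc, ← div_eq_mul_inv, div_le_iff₀ h2m0]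
    have hpos : (0 : ℝ) ≤ 2 ^ m * 2 ^ (7 * -δ * m) := by positivity
    nlinarith
  have h3 : (0 : ℝ) ≤ 3 * (((2 ^ m) ^ 7 : ℕ) : ℝ) ^ (-δ) := by positivity
  rw [ENNReal.ofReal_sub _ h3, ENNReal.ofReal_one, tsub_le_iff_right]
  refine hmain.trans (add_le_add_right ?_ _)
  exact (mul_le_mul_right hη 2).trans hfin
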